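/- Let $(M,g)$ be a smooth connected Riemannian manifold without boundary (Hausdorff, second countable), with Riemannian measure $\nu$, and let $L^p(M)=L^p(M,\nu)$ be the real Lebesgue space. A simple $H$-operator is a map $H_{\varphi,\Phi,V}:C_0(M)\to C_0(M)$, $H_{\varphi,\Phi,V}f(x)=\varphi(x)f(\Phi(x))$ for $x\in V$ and $0$ for $x\notin V$, where $\Phi:V\to V'$ is a $C^\infty$ diffeomorphism between open subsets of $M$ and $\varphi\in C^\infty(M)$ is real-valued and compactly supported with $\operatorname{supp}\varphi\subset V$. An $H$-operator localized on an open set $U\subset M$ is a finite linear combination of simple $H$-operators $H_{\varphi,\Phi,V}$ with $V\subset U$ and $\Phi(V)\subset U$; if $U$ is precompact it is identified with the bounded operator on $L^p(M)$, $1\le p<\infty$, that it induces. Let $\mathcal U$ be a cover of $M$ by open precompact sets and $1\le p<\infty$. A family $\{P_U\}_{U\in\mathcal U}$ is a smooth decomposition of identity in $L^p(M)$ subordinate to $\mathcal U$ if (i) for every compact $K\subset M$, only finitely many $U\in\mathcal U$ satisfy both $U\cap K\neq\emptyset$ and $P_U\neq0$; (ii) each $P_U$ is an $H$-operator localized on $U$;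 (iii) each $P_U:L^p(M)\to L^p(M)$ is a projection; (iv) $P_U\circ P_{U'}=0$ for $U\ne U'$ in $\mathcal U$; (v) $\sum_{U\in\mathcal U}P_U=\mathbf I$ on $L^p(M)$, with unconditional convergence in the strong operator topology; (vi) there is a constant $C>0$ (a decomposition constant) such that $\frac1C\|f\|_p\le\big(\sum_{U\in\mathcal U}\|P_Uf\|_p^p\big)^{1/p}\le C\|f\|_p$ for all $f\in L^p(M)$. **Theorem.** Let $1<p<\infty$, $1/p+1/p'=1$, and let $\{P_U\}_{U\in\mathcal U}$ be a smooth decomposition of identity in $L^p(M)$ subordinate to $\mathcal U$. Then each $P_U$ has a unique adjoint $(P_U)^*:L^{p'}(M)\to L^{p'}(M)$, that is, a unique bounded operator with $\int_M (P_Uf)\,h\,d\nu=\int_M f\,(P_U)^*h\,d\nu$ for all $f\in L^p(M)$, $h\in L^{p'}(M)$, and $\{(P_U)^*\}_{U\in\mathcal U}$ is a smooth decomposition of identity in $L^{p'}(M)$ subordinate to the same cover $\mathcal U$. In particular each $(P_U)^*$ is again an $H$-operator localized on $U$. Moreover, if $p=2$ and $C=1$ is a decomposition constant of $\{P_U\}$,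 then $C=1$ is a decomposition constant of $\{(P_U)^*\}$. -/

import Mathlib

open Bundle MeasureTheory Set
open scoped Manifold ContDiff ENNReal ZeroAtInfty

noncomputable section

namespace HestenesDecomposition

/-! Throughout, a smooth manifold without boundary of dimension `d` is modelled on
`EuclideanSpace ℝ (Fin d)`, with model with corners `𝓡 d`. -/

/-- A smooth Riemannian metric on the `d`-dimensional manifold `M`. -/
abbrev SmoothRiemannianMetric (d : ℕ) (M : Type*) [TopologicalSpace M]
    [ChartedSpace (EuclideanSpace ℝ (Fin d)) M] [IsManifold (𝓡 d) ∞ M] :=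
  ContMDiffRiemannianMetric (𝓡 d) ∞ (EuclideanSpace ℝ (Fin d))
    (fun x : M => TangentSpace (𝓡 d) x)

section Measure

variable {d : ℕ} {M : Type*} [TopologicalSpace M]
  [ChartedSpace (EuclideanSpace ℝ (Fin d)) M] [IsManifold (𝓡 d) ∞ M]

/-- The `i`-th coordinate vector field of the chart `e`, at the point with coordinates `y`. -/
def coordVector (e : OpenPartialHomeomorph M (EuclideanSpace ℝ (Fin d)))
    (y : EuclideanSpace ℝ (Fin d)) (i : Fin d) : TangentSpace (𝓡 d) (e.symm y) :=
  mfderiv (𝓡 d) (𝓡 d) e.symm y (EuclideanSpace.single i (1 : ℝ))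

/-- The matrix `(g_ij)` of the metric in the chart `e`, at the point with coordinates `y`. -/
def gramMatrix (g : SmoothRiemannianMetric d M)
    (e : OpenPartialHomeomorph M (EuclideanSpace ℝ (Fin d)))
    (y : EuclideanSpace ℝ (Fin d)) : Matrix (Fin d) (Fin d) ℝ :=
  Matrix.of fun i j => g.inner (e.symm y) (coordVector e y i) (coordVector e y j)

/-- The measure `√(det g_ij) dy` on the target of the chart `e`, carried to `M`. -/
def chartMeasure [MeasurableSpace M] (g : SmoothRiemannianMetric d M)
    (e : OpenPartialHomeomorph M (EuclideanSpace ℝ (Fin d))) : Measure M :=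
  (((volume : Measure (EuclideanSpace ℝ (Fin d))).restrict e.target).withDensity
    fun y => ENNReal.ofReal (Real.sqrt (gramMatrix g e y).det)).map e.symm

/-- The Riemannian measure of `g`: the least measure that dominates `√(det g_ij) dy` in every
smooth chart. As these local measures agree where charts overlap, on a second countable manifold
it is the measure which coincides with `√(det g_ij) dy` in every smooth chart. -/
def riemannianMeasure [MeasurableSpace M] (g : SmoothRiemannianMetric d M) : Measure M :=
  ⨆ e ∈ IsManifold.maximalAtlas (𝓡 d) ∞ M, chartMeasure g e

end Measure

section HOperators

variable (d : ℕ) {M : Type*} [TopologicalSpace M]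
  [ChartedSpace (EuclideanSpace ℝ (Fin d)) M]

open Classical in
/-- The function `H_{φ,Φ,V} f`, equal to `φ · (f ∘ Φ)` on the domain `V` of `Φ` and to `0`
elsewhere. -/
def simpleHFun (φ : M → ℝ) (Φ : OpenPartialHomeomorph M M) (f : M → ℝ) (x : M) : ℝ :=
  if x ∈ Φ.source then φ x * f (Φ x) else 0

/-- `T` is a simple `H`-operator `H_{φ,Φ,V}` on `C₀(M)` with `V ⊆ U` and `Φ(V) ⊆ U`. Here
`V = Φ.source` and `Φ(V) = Φ.target` are open, `Φ` is a `C^∞` diffeomorphism between them, and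
`φ` is a compactly supported `C^∞` function with `supp φ ⊆ V`. -/
def IsSimpleHOperatorIn (U : Set M) (T : C₀(M, ℝ) →L[ℝ] C₀(M, ℝ)) : Prop :=
  ∃ (φ : M → ℝ) (Φ : OpenPartialHomeomorph M M),
    ContMDiffOn (𝓡 d) (𝓡 d) ∞ Φ Φ.source ∧
    ContMDiffOn (𝓡 d) (𝓡 d) ∞ Φ.symm Φ.target ∧
    ContMDiff (𝓡 d) 𝓘(ℝ, ℝ) ∞ φ ∧
    HasCompactSupport φ ∧ tsupport φ ⊆ Φ.source ∧
    Φ.source ⊆ U ∧ Φ.target ⊆ U ∧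
    ∀ (f : C₀(M, ℝ)) (x : M), T f x = simpleHFun φ Φ f x

/-- The `H`-operators localized on `U`: the finite linear combinations of simple `H`-operators
`H_{φ,Φ,V}` with `V ⊆ U` and `Φ(V) ⊆ U`. For `U = univ` this is the space of all
`H`-operators. -/
def localizedHOperators (U : Set M) : Submodule ℝ (C₀(M, ℝ) →L[ℝ] C₀(M, ℝ)) :=
  Submodule.span ℝ {T | IsSimpleHOperatorIn d U T}

end HOperators

section Lp

variable {M : Type*} [MeasurableSpace M]

/-- `A` is the bounded operator on `L^p(ν)` induced by the operator `T` on `C₀(M)`: the two agree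
on `C₀(M) ∩ L^p(ν)`. -/
def IsLpExtension [TopologicalSpace M] (ν : Measure M) (p : ℝ≥0∞) [Fact (1 ≤ p)]
    (T : C₀(M, ℝ) →L[ℝ] C₀(M, ℝ)) (A : Lp ℝ p ν →L[ℝ] Lp ℝ p ν) : Prop :=
  ∀ (f : C₀(M, ℝ)) (hf : MemLp (f : M → ℝ) p ν), A (hf.toLp f) =ᵐ[ν] T f

/-- `B`, acting on `L^q(ν)`, is the adjoint of `A`, acting on `L^p(ν)`, with respect to the
pairing `∫ f g dν` of the conjugate exponents `p` and `q`. -/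
def IsLpAdjoint (ν : Measure M) (p q : ℝ≥0∞) [Fact (1 ≤ p)] [Fact (1 ≤ q)]
    (A : Lp ℝ p ν →L[ℝ] Lp ℝ p ν) (B : Lp ℝ q ν →L[ℝ] Lp ℝ q ν) : Prop :=
  ∀ (f : Lp ℝ p ν) (g : Lp ℝ q ν), ∫ x, A f x * g x ∂ν = ∫ x, f x * B g x ∂ν

/-- `C` is a decomposition constant of the family `A`:
`C⁻¹ ‖f‖ ≤ (∑ ‖A i f‖ ^ p) ^ (1 / p) ≤ C ‖f‖` for all `f` in `L^p`. -/
def IsDecompositionConstant {ι : Type*} (ν : Measure M) (p : ℝ≥0∞) [Fact (1 ≤ p)]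
    (A : ι → Lp ℝ p ν →L[ℝ] Lp ℝ p ν) (C : ℝ) : Prop :=
  0 < C ∧ ∀ f : Lp ℝ p ν,
    Summable (fun i => ‖A i f‖ ^ p.toReal) ∧
    1 / C * ‖f‖ ≤ (∑' i, ‖A i f‖ ^ p.toReal) ^ (1 / p.toReal) ∧
    (∑' i, ‖A i f‖ ^ p.toReal) ^ (1 / p.toReal) ≤ C * ‖f‖

end Lp

/-- `𝒰` is a cover of `M` by open and precompact sets. -/
def IsOpenPrecompactCover {M : Type*} [TopologicalSpace M] (𝒰 : Set (Set M)) : Prop :=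
  (∀ U ∈ 𝒰, IsOpen U ∧ IsCompact (closure U)) ∧ ⋃₀ 𝒰 = univ

/-- The family `(P U)_{U ∈ 𝒰}` is a smooth decomposition of identity in `L^p(M)`, `1 ≤ p < ∞`,
subordinate to the cover `𝒰`. An `H`-operator localized on a precompact open set is identified
with the bounded operator that it induces on `L^p(M)`. -/
structure IsSmoothDecomposition {d : ℕ} {M : Type*} [TopologicalSpace M]
    [ChartedSpace (EuclideanSpace ℝ (Fin d)) M] [IsManifold (𝓡 d) ∞ M] [MeasurableSpace M]
    (g : SmoothRiemannianMetric d M) (𝒰 : Set (Set M)) (p : ℝ≥0∞) [Fact (1 ≤ p)]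
    (P : 𝒰 → Lp ℝ p (riemannianMeasure g) →L[ℝ] Lp ℝ p (riemannianMeasure g)) : Prop where
  /-- the family is locally finite -/
  locally_finite : ∀ K : Set M, IsCompact K →
    {U : 𝒰 | ((U : Set M) ∩ K).Nonempty ∧ P U ≠ 0}.Finite
  /-- `P U` is an `H`-operator localized on `U` -/
  localized : ∀ U : 𝒰, ∃ T ∈ localizedHOperators d (U : Set M),
    IsLpExtension (riemannianMeasure g) p T (P U)
  /-- `P U` is a projection -/
  projection : ∀ U : 𝒰, (P U).comp (P U) = P U
  comp_eq_zero : ∀ U U' : 𝒰, U ≠ U' → (P U).comp (P U') = 0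
  /-- `∑ P U = I`, unconditionally in the strong operator topology -/
  hasSum : ∀ f : Lp ℝ p (riemannianMeasure g), HasSum (fun U => P U f) f
  exists_constant : ∃ C : ℝ, IsDecompositionConstant (riemannianMeasure g) p P C

end HestenesDecomposition

end

/-! The adjoint of a simple `H`-operator is computed by substitution. With `J` the density of the
image measure `Φ_*ν` with respect to `ν`, setting `y = Φ x` in `∫ φ · (f ∘ Φ) · h` produces `∫ f ·
(J · φ ∘ Φ⁻¹) · (h ∘ Φ⁻¹)`, the operator with diffeomorphism `Φ⁻¹` and weight `J · φ ∘ Φ⁻¹`. Source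
and target are exchanged, so localization on `U` survives, and the weight is smooth with compact
support because `J` is smooth (`contMDiffOn_transferDensity`, `map_restrict_riemannianMeasure`).
Linearity gives `exists_adjoint_mem_localizedHOperators`, and density of `C₀ ∩ L^q` with the norm
estimate `norm_le_of_pairing_eq` carries the adjoint to `L^q`.

The rest is duality for a pairing with norming elements, which in `L^p` are `sign h · |h|^(q-1)`.
Products reverse under adjoints. The upper bound for the adjoint family comes from testing `h`
against a finite sum `∑ P_i f_i`, where `f_i` norms `Q_i h` (`sum_norm_adjoint_le`); the lower bound
comes from expanding a norming element of `h` and applying Hölder to the series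
(`norm_le_tsum_adjoint`). These bounds yield unconditional convergence of `∑ Q_i h`, and the pairing
identifies its sum. -/

noncomputable section

namespace HestenesDecomposition

/-! ### Riemannian density in a chart: transformation rule, positivity, smoothness. -/

section Density

variable {d : ℕ} {M : Type*} [TopologicalSpace M]
  [ChartedSpace (EuclideanSpace ℝ (Fin d)) M] [IsManifold (𝓡 d) ∞ M]

/-- The pullback of the metric under a map from the model space, at the point `y`. -/
def pullbackForm (g : SmoothRiemannianMetric d M) (F : EuclideanSpace ℝ (Fin d) → M)
    (y : EuclideanSpace ℝ (Fin d)) : LinearMap.BilinForm ℝ (EuclideanSpace ℝ (Fin d)) :=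
  LinearMap.mk₂ ℝ (fun v w => g.inner (F y) (mfderiv (𝓡 d) (𝓡 d) F y v)
      (mfderiv (𝓡 d) (𝓡 d) F y w))
    (fun v v' w => by
      have h : mfderiv (𝓡 d) (𝓡 d) F y (v + v') =
        mfderiv (𝓡 d) (𝓡 d) F y v + mfderiv (𝓡 d) (𝓡 d) F y v' := map_add _ _ _
      rw [h, map_add]; rfl)
    (fun c v w => by
      have h : mfderiv (𝓡 d) (𝓡 d) F y (c • v) = c • mfderiv (𝓡 d) (𝓡 d) F y v := map_smul _ _ _
      rw [h, map_smul]; rfl)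
    (fun v w w' => by
      have h : mfderiv (𝓡 d) (𝓡 d) F y (w + w') =
        mfderiv (𝓡 d) (𝓡 d) F y w + mfderiv (𝓡 d) (𝓡 d) F y w' := map_add _ _ _
      rw [h, map_add])
    (fun c v w => by
      have h : mfderiv (𝓡 d) (𝓡 d) F y (c • w) = c • mfderiv (𝓡 d) (𝓡 d) F y w := map_smul _ _ _
      rw [h, map_smul])

/-- Chain rule. Only the germ of `F` at `y` matters, and tangent spaces are read as the model space
so that the two differentials compose. -/
theorem pullbackForm_comp (g : SmoothRiemannianMetric d M) {F F' : EuclideanSpace ℝ (Fin d) → M}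
    {ψ : EuclideanSpace ℝ (Fin d) → EuclideanSpace ℝ (Fin d)} {y : EuclideanSpace ℝ (Fin d)}
    (hF : F =ᶠ[nhds y] F' ∘ ψ) (hψ : DifferentiableAt ℝ ψ y)
    (hF' : MDifferentiableAt (𝓡 d) (𝓡 d) F' (ψ y)) :
    pullbackForm g F y = (pullbackForm g F' (ψ y)).comp (fderiv ℝ ψ y) (fderiv ℝ ψ y) := by
  have hd : (mfderiv (𝓡 d) (𝓡 d) F y : EuclideanSpace ℝ (Fin d) →L[ℝ] EuclideanSpace ℝ (Fin d)) =
      (mfderiv (𝓡 d) (𝓡 d) F' (ψ y) : EuclideanSpace ℝ (Fin d) →L[ℝ]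
        EuclideanSpace ℝ (Fin d)).comp (fderiv ℝ ψ y) := by
    have h1 := hF.mfderiv_eq (I := 𝓡 d) (I' := 𝓡 d)
    have h2 := mfderiv_comp (I := 𝓡 d) (I' := 𝓡 d) (I'' := 𝓡 d) y hF' hψ.mdifferentiableAt
    rw [mfderiv_eq_fderiv] at h2
    exact h1.trans h2
  have hi : (g.inner (F y) : EuclideanSpace ℝ (Fin d) →L[ℝ] EuclideanSpace ℝ (Fin d) →L[ℝ] ℝ) =
      g.inner (F' (ψ y)) := by
    have := hF.self_of_nhds
    rw [this]; rfl
  ext v w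
  have h1 : pullbackForm g F y v w =
    (g.inner (F y) : EuclideanSpace ℝ (Fin d) →L[ℝ] EuclideanSpace ℝ (Fin d) →L[ℝ] ℝ)
     ((mfderiv (𝓡 d) (𝓡 d) F y : EuclideanSpace ℝ (Fin d) →L[ℝ] EuclideanSpace ℝ (Fin d)) v)
     ((mfderiv (𝓡 d) (𝓡 d) F y : EuclideanSpace ℝ (Fin d) →L[ℝ] EuclideanSpace ℝ (Fin d)) w) := rfl
  rw [h1, hd, hi]
  rfl

theorem gramMatrix_eq_toMatrix (g : SmoothRiemannianMetric d M)
    (e : OpenPartialHomeomorph M (EuclideanSpace ℝ (Fin d))) (y : EuclideanSpace ℝ (Fin d)) :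
    gramMatrix g e y = LinearMap.BilinForm.toMatrix
      (EuclideanSpace.basisFun (Fin d) ℝ).toBasis (pullbackForm g e.symm y) := by
  ext i j
  rw [LinearMap.BilinForm.toMatrix_apply]
  simp only [OrthonormalBasis.coe_toBasis, EuclideanSpace.basisFun_apply]
  rfl

/-- The density `√(det g_ij)` of the Riemannian measure in the chart `e`. -/
def chartDensity (g : SmoothRiemannianMetric d M)
    (e : OpenPartialHomeomorph M (EuclideanSpace ℝ (Fin d))) (y : EuclideanSpace ℝ (Fin d)) : ℝ :=
  Real.sqrt (gramMatrix g e y).det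

/-- The Gram determinant is multiplied by the square of `det dψ`, and the root leaves the absolute
value. The germ hypothesis allows for pairs such as `Φ.trans e` and `Φ.trans e'` besides two
overlapping charts. -/
theorem chartDensity_comp (g : SmoothRiemannianMetric d M)
    {e e' : OpenPartialHomeomorph M (EuclideanSpace ℝ (Fin d))}
    {ψ : EuclideanSpace ℝ (Fin d) → EuclideanSpace ℝ (Fin d)} {y : EuclideanSpace ℝ (Fin d)}
    (h : e.symm =ᶠ[nhds y] e'.symm ∘ ψ) (hψ : DifferentiableAt ℝ ψ y)
    (he' : MDifferentiableAt (𝓡 d) (𝓡 d) e'.symm (ψ y)) :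
    chartDensity g e y = |(fderiv ℝ ψ y).det| * chartDensity g e' (ψ y) := by
  rw [chartDensity, gramMatrix_eq_toMatrix, pullbackForm_comp g h hψ he',
    LinearMap.BilinForm.toMatrix_comp (EuclideanSpace.basisFun (Fin d) ℝ).toBasis
      (EuclideanSpace.basisFun (Fin d) ℝ).toBasis, Matrix.det_mul, Matrix.det_mul,
    Matrix.det_transpose, LinearMap.det_toMatrix, ← gramMatrix_eq_toMatrix]
  rw [show ∀ a b : ℝ, a * b * a = a ^ 2 * b by intros; ring, Real.sqrt_mul (sq_nonneg _),
    Real.sqrt_sq_eq_abs]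
  rfl

/-- The differential of an inverse chart is injective, so the pulled-back metric stays positive
definite. This is what makes the square root smooth and quotients of densities legitimate. -/
theorem det_gramMatrix_pos (g : SmoothRiemannianMetric d M)
    {e : OpenPartialHomeomorph M (EuclideanSpace ℝ (Fin d))}
    (he : e ∈ IsManifold.maximalAtlas (𝓡 d) ∞ M) {y : EuclideanSpace ℝ (Fin d)}
    (hy : y ∈ e.target) : 0 < (gramMatrix g e y).det := by
  have hinj : Function.Injective (mfderiv (𝓡 d) (𝓡 d) e.symm y) := by
    have hmd : e.MDifferentiable (𝓡 d) (𝓡 d) :=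
      ⟨(contMDiffOn_of_mem_maximalAtlas he).mdifferentiableOn (by simp),
        (contMDiffOn_symm_of_mem_maximalAtlas he).mdifferentiableOn (by simp)⟩
    exact hmd.symm.mfderiv_injective (x := y) hy
  apply Matrix.PosDef.det_pos
  rw [gramMatrix_eq_toMatrix]
  refine Matrix.PosDef.of_dotProduct_mulVec_pos ?_ ?_
  · ext i j
    rw [Matrix.conjTranspose_apply, LinearMap.BilinForm.toMatrix_apply,
      LinearMap.BilinForm.toMatrix_apply, star_trivial]
    exact g.symm _ _ _
  · intro x hx
    have key := LinearMap.BilinForm.apply_eq_dotProduct_toMatrix_mulVec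
      (EuclideanSpace.basisFun (Fin d) ℝ).toBasis (pullbackForm g e.symm y)
      (WithLp.toLp 2 x) (WithLp.toLp 2 x)
    have hx' : ⇑((EuclideanSpace.basisFun (Fin d) ℝ).toBasis.repr (WithLp.toLp 2 x)) = x := by
      ext i; simp
    rw [hx'] at key
    rw [star_trivial, ← key]
    refine g.pos _ _ fun h0 => hx ?_
    have h1 : mfderiv (𝓡 d) (𝓡 d) e.symm y (WithLp.toLp 2 x) =
      mfderiv (𝓡 d) (𝓡 d) e.symm y 0 := by rw [h0]; exact (map_zero _).symm
    have := hinj h1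
    have h2 : (WithLp.toLp 2 x : EuclideanSpace ℝ (Fin d)) = 0 := this
    ext i
    exact congrFun (congrArg WithLp.ofLp h2) i

theorem chartDensity_pos (g : SmoothRiemannianMetric d M)
    {e : OpenPartialHomeomorph M (EuclideanSpace ℝ (Fin d))}
    (he : e ∈ IsManifold.maximalAtlas (𝓡 d) ∞ M) {y : EuclideanSpace ℝ (Fin d)}
    (hy : y ∈ e.target) : 0 < chartDensity g e y :=
  Real.sqrt_pos.2 (det_gramMatrix_pos g he hy)

theorem contMDiffOn_coordVector {e : OpenPartialHomeomorph M (EuclideanSpace ℝ (Fin d))}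
    (he : e ∈ IsManifold.maximalAtlas (𝓡 d) ∞ M) (i : Fin d) :
    ContMDiffOn (𝓡 d) (𝓡 d).tangent ∞
      (fun y => (TotalSpace.mk' (EuclideanSpace ℝ (Fin d)) (e.symm y) (coordVector e y i) :
        TangentBundle (𝓡 d) M)) e.target := by
  have h1 := (contMDiffOn_symm_of_mem_maximalAtlas he).contMDiffOn_tangentMapWithin (m := ∞)
    (by simp) e.open_target.uniqueMDiffOn
  have h2 : ContMDiff (𝓡 d) (𝓡 d).tangent ∞
      (fun y : EuclideanSpace ℝ (Fin d) => (TotalSpace.mk' (EuclideanSpace ℝ (Fin d)) y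
        (EuclideanSpace.single i (1 : ℝ)) :
        TangentBundle (𝓡 d) (EuclideanSpace ℝ (Fin d)))) := by
    exact contMDiff_vectorSpace_iff_contDiff.2 contDiff_const
  refine (h1.comp h2.contMDiffOn (s := e.target) fun y hy => hy).congr fun y hy => ?_
  simp only [tangentMapWithin, Function.comp, coordVector]
  rw [mfderivWithin_of_isOpen e.open_target hy]

theorem contMDiffOn_gramMatrix_apply (g : SmoothRiemannianMetric d M)
    {e : OpenPartialHomeomorph M (EuclideanSpace ℝ (Fin d))}
    (he : e ∈ IsManifold.maximalAtlas (𝓡 d) ∞ M) (i j : Fin d) :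
    ContMDiffOn (𝓡 d) 𝓘(ℝ, ℝ) ∞ (fun y => gramMatrix g e y i j) e.target := by
  have h := ContMDiffOn.clm_bundle_apply₂ (F₁ := EuclideanSpace ℝ (Fin d))
    (F₂ := EuclideanSpace ℝ (Fin d)) (F₃ := ℝ) (E₁ := fun x : M => TangentSpace (𝓡 d) x)
    (E₂ := fun x : M => TangentSpace (𝓡 d) x) (E₃ := Bundle.Trivial M ℝ) (b := e.symm)
    (ψ := fun y => g.inner (e.symm y))
    (g.contMDiff.comp_contMDiffOn (contMDiffOn_symm_of_mem_maximalAtlas he))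
    (contMDiffOn_coordVector he i) (contMDiffOn_coordVector he j)
  intro y hy
  have := h y hy
  rw [Bundle.contMDiffWithinAt_totalSpace] at this
  exact this.2

theorem contMDiffOn_chartDensity (g : SmoothRiemannianMetric d M)
    {e : OpenPartialHomeomorph M (EuclideanSpace ℝ (Fin d))}
    (he : e ∈ IsManifold.maximalAtlas (𝓡 d) ∞ M) :
    ContMDiffOn (𝓡 d) 𝓘(ℝ, ℝ) ∞ (chartDensity g e) e.target := by
  have h : ContDiffOn ℝ ∞ (fun y => (gramMatrix g e y).det) e.target := by
    simp only [Matrix.det_apply']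
    exact ContDiffOn.sum fun σ _ => contDiffOn_const.mul (contDiffOn_prod fun i _ =>
      (contMDiffOn_gramMatrix_apply g he _ _).contDiffOn)
  exact (h.sqrt fun y hy => (det_gramMatrix_pos g he hy).ne').contMDiffOn

end Density

/-! ### Measurability through charts and transition maps. -/

theorem measurableSet_inter_preimage_of_continuousOn {X Y : Type*} [TopologicalSpace X]
    [MeasurableSpace X] [OpensMeasurableSpace X] [TopologicalSpace Y] [MeasurableSpace Y]
    [BorelSpace Y] {f : X → Y} {s : Set X} {t : Set Y} (hf : ContinuousOn f s)
    (hs : MeasurableSet s) (ht : MeasurableSet t) : MeasurableSet (s ∩ f ⁻¹' t) := by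
  have h := (continuousOn_iff_continuous_domRestrict.1 hf).measurable ht
  have := hs.subtype_image h
  convert this using 1
  ext x
  simp [Set.domRestrict, and_comm]

theorem measurableSet_chart_target_inter {E M : Type*} [TopologicalSpace E] [MeasurableSpace E]
    [OpensMeasurableSpace E] [TopologicalSpace M] [MeasurableSpace M] [BorelSpace M]
    (e : OpenPartialHomeomorph M E) {A : Set M} (hA : MeasurableSet A) :
    MeasurableSet (e.target ∩ e.symm ⁻¹' A) :=
  measurableSet_inter_preimage_of_continuousOn e.continuousOn_symm e.open_target.measurableSet hA

section Transition

variable {d : ℕ} {M : Type*} [TopologicalSpace M]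
  [ChartedSpace (EuclideanSpace ℝ (Fin d)) M]

theorem contDiffOn_transition {e e' : OpenPartialHomeomorph M (EuclideanSpace ℝ (Fin d))}
    (he : e ∈ IsManifold.maximalAtlas (𝓡 d) ∞ M) (he' : e' ∈ IsManifold.maximalAtlas (𝓡 d) ∞ M) :
    ContDiffOn ℝ ∞ (e' ∘ e.symm) (e.target ∩ e.symm ⁻¹' e'.source) :=
  ((contMDiffOn_of_mem_maximalAtlas he').comp
    ((contMDiffOn_symm_of_mem_maximalAtlas he).mono inter_subset_left)
    fun _ hy => hy.2).contDiffOn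

theorem differentiableAt_transition {e e' : OpenPartialHomeomorph M (EuclideanSpace ℝ (Fin d))}
    (he : e ∈ IsManifold.maximalAtlas (𝓡 d) ∞ M) (he' : e' ∈ IsManifold.maximalAtlas (𝓡 d) ∞ M)
    {y : EuclideanSpace ℝ (Fin d)} (hy : y ∈ e.target) (hy' : e.symm y ∈ e'.source) :
    DifferentiableAt ℝ (e' ∘ e.symm) y :=
  ((contDiffOn_transition he he').differentiableOn (by simp)).differentiableAt
    ((e.isOpen_inter_preimage_symm e'.open_source).mem_nhds ⟨hy, hy'⟩)

variable [IsManifold (𝓡 d) ∞ M]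

theorem chartDensity_transition (g : SmoothRiemannianMetric d M)
    {e e' : OpenPartialHomeomorph M (EuclideanSpace ℝ (Fin d))}
    (he : e ∈ IsManifold.maximalAtlas (𝓡 d) ∞ M) (he' : e' ∈ IsManifold.maximalAtlas (𝓡 d) ∞ M)
    {y : EuclideanSpace ℝ (Fin d)} (hy : y ∈ e.target) (hy' : e.symm y ∈ e'.source) :
    chartDensity g e y =
      |(fderiv ℝ (e' ∘ e.symm) y).det| * chartDensity g e' (e' (e.symm y)) := by
  refine chartDensity_comp g (ψ := e' ∘ e.symm) ?_ (differentiableAt_transition he he' hy hy') ?_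
  · filter_upwards [(e.isOpen_inter_preimage_symm e'.open_source).mem_nhds ⟨hy, hy'⟩] with z hz
    exact (e'.left_inv hz.2).symm
  · exact ((contMDiffOn_symm_of_mem_maximalAtlas he').mdifferentiableOn (by simp)).mdifferentiableAt
      (e'.open_target.mem_nhds (e'.map_source hy'))

end Transition

/-! ### The Riemannian measure in a single chart. -/

section Measure

variable {d : ℕ} {M : Type*} [TopologicalSpace M]
  [ChartedSpace (EuclideanSpace ℝ (Fin d)) M] [IsManifold (𝓡 d) ∞ M]
  [MeasurableSpace M] [BorelSpace M]

theorem aemeasurable_chart_symm (g : SmoothRiemannianMetric d M)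
    (e : OpenPartialHomeomorph M (EuclideanSpace ℝ (Fin d))) :
    AEMeasurable e.symm (((volume : Measure (EuclideanSpace ℝ (Fin d))).restrict
      e.target).withDensity fun y => ENNReal.ofReal (chartDensity g e y)) :=
  (e.continuousOn_symm.aemeasurable e.open_target.measurableSet).mono_ac
    (withDensity_absolutelyContinuous _ _)

theorem chartMeasure_apply (g : SmoothRiemannianMetric d M)
    (e : OpenPartialHomeomorph M (EuclideanSpace ℝ (Fin d))) {A : Set M} (hA : MeasurableSet A) :
    chartMeasure g e A =
      ∫⁻ y in e.target ∩ e.symm ⁻¹' A, ENNReal.ofReal (chartDensity g e y) := by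
  rw [chartMeasure]
  change Measure.map e.symm (((volume : Measure (EuclideanSpace ℝ (Fin d))).restrict
      e.target).withDensity fun y => ENNReal.ofReal (chartDensity g e y)) A = _
  rw [Measure.map_apply_of_aemeasurable (aemeasurable_chart_symm g e) hA, withDensity_apply',
    Measure.restrict_restrict' e.open_target.measurableSet, inter_comm]

/-- Change of variables along the transition map: its Jacobian is exactly the factor in
`chartDensity_transition`. -/
theorem chartMeasure_apply_eq (g : SmoothRiemannianMetric d M)
    {e e' : OpenPartialHomeomorph M (EuclideanSpace ℝ (Fin d))}
    (he : e ∈ IsManifold.maximalAtlas (𝓡 d) ∞ M) (he' : e' ∈ IsManifold.maximalAtlas (𝓡 d) ∞ M)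
    {A : Set M} (hA : MeasurableSet A) (hAe : A ⊆ e.source) (hAe' : A ⊆ e'.source) :
    chartMeasure g e A = chartMeasure g e' A := by
  have himg : e'.target ∩ e'.symm ⁻¹' A = (e' ∘ e.symm) '' (e.target ∩ e.symm ⁻¹' A) := by
    ext z
    constructor
    · rintro ⟨hz, hzA⟩
      refine ⟨e (e'.symm z), ⟨e.map_source (hAe hzA), ?_⟩, ?_⟩
      · simpa [e.left_inv (hAe hzA)] using hzA
      · simp [e.left_inv (hAe hzA), e'.right_inv hz]
    · rintro ⟨y, ⟨hy, hyA⟩, rfl⟩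
      refine ⟨e'.map_source (hAe' hyA), ?_⟩
      simpa [e'.left_inv (hAe' hyA)] using hyA
  rw [chartMeasure_apply g e hA, chartMeasure_apply g e' hA, himg,
    lintegral_image_eq_lintegral_abs_det_fderiv_mul volume (measurableSet_chart_target_inter e hA)
      (f' := fderiv ℝ (e' ∘ e.symm))
      (fun y hy => (differentiableAt_transition he he' hy.1
        (hAe' hy.2)).hasFDerivAt.hasFDerivWithinAt)]
  · refine setLIntegral_congr_fun (measurableSet_chart_target_inter e hA) fun y hy => ?_
    rw [chartDensity_transition g he he' hy.1 (hAe' hy.2), ENNReal.ofReal_mul (abs_nonneg _)]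
    rfl
  · intro y hy z hz hyz
    exact e.symm.injOn hy.1 hz.1 (e'.injOn (hAe' hy.2) (hAe' hz.2) hyz)

/-- The supremum over all charts adds nothing on `e.source`, since the chart measures agree on
overlaps. -/
theorem riemannianMeasure_restrict_chart_source (g : SmoothRiemannianMetric d M)
    {e : OpenPartialHomeomorph M (EuclideanSpace ℝ (Fin d))}
    (he : e ∈ IsManifold.maximalAtlas (𝓡 d) ∞ M) :
    (riemannianMeasure g).restrict e.source = chartMeasure g e := by
  have hs := e.open_source.measurableSet
  have hsupp : ∀ e' : OpenPartialHomeomorph M (EuclideanSpace ℝ (Fin d)),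
      (chartMeasure g e') e'.sourceᶜ = 0 := fun e' => by
    rw [chartMeasure_apply g e' e'.open_source.measurableSet.compl]
    have : e'.target ∩ e'.symm ⁻¹' e'.sourceᶜ = ∅ := by
      ext y
      simpa using fun hy => e'.map_target hy
    rw [this, Measure.restrict_empty, lintegral_zero_measure]
  have hrestr : ∀ e' : OpenPartialHomeomorph M (EuclideanSpace ℝ (Fin d)),
      (chartMeasure g e').restrict e'.source = chartMeasure g e' := fun e' =>
    Measure.restrict_eq_self_of_ae_mem (by rw [ae_iff]; exact hsupp e')
  apply le_antisymm
  -- The right-hand side dominates every chart measure: inside `e.source` by agreement on the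
  -- overlap, outside by definition of the supremum. Restricting to `e.source` then removes the
  -- second summand.
  · have hle : riemannianMeasure g ≤
        chartMeasure g e + (riemannianMeasure g).restrict e.sourceᶜ := by
      refine iSup₂_le fun e' he' => ?_
      rw [← Measure.restrict_add_restrict_compl (μ := chartMeasure g e') hs]
      refine add_le_add (Measure.le_iff.2 fun A hA => ?_) (Measure.restrict_mono le_rfl
        (le_iSup₂_of_le e' he' le_rfl))
      rw [Measure.restrict_apply hA, ← hrestr e', Measure.restrict_apply (hA.inter hs),
        chartMeasure_apply_eq g he' he ((hA.inter hs).inter e'.open_source.measurableSet)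
          inter_subset_right (inter_subset_left.trans inter_subset_right)]
      exact measure_mono (inter_subset_left.trans inter_subset_left)
    calc (riemannianMeasure g).restrict e.source
        ≤ (chartMeasure g e + (riemannianMeasure g).restrict e.sourceᶜ).restrict e.source :=
          Measure.restrict_mono le_rfl hle
      _ = chartMeasure g e := by
          rw [Measure.restrict_add, Measure.restrict_restrict hs, inter_compl_self, hrestr,
            Measure.restrict_empty, add_zero]
  · rw [← hrestr e]
    exact Measure.restrict_mono le_rfl (le_iSup₂_of_le e he le_rfl)

theorem riemannianMeasure_apply_of_subset_source (g : SmoothRiemannianMetric d M)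
    {e : OpenPartialHomeomorph M (EuclideanSpace ℝ (Fin d))}
    (he : e ∈ IsManifold.maximalAtlas (𝓡 d) ∞ M) {A : Set M} (hA : MeasurableSet A)
    (hAe : A ⊆ e.source) :
    riemannianMeasure g A =
      ∫⁻ y in e.target ∩ e.symm ⁻¹' A, ENNReal.ofReal (chartDensity g e y) := by
  rw [← chartMeasure_apply g e hA, ← riemannianMeasure_restrict_chart_source g he,
    Measure.restrict_apply hA, inter_eq_left.2 hAe]

instance isLocallyFiniteMeasure_riemannianMeasure [T2Space M] (g : SmoothRiemannianMetric d M) :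
    IsLocallyFiniteMeasure (riemannianMeasure g) := by
  refine ⟨fun x => ?_⟩
  let e := chartAt (EuclideanSpace ℝ (Fin d)) x
  have he : e ∈ IsManifold.maximalAtlas (𝓡 d) ∞ M := IsManifold.chart_mem_maximalAtlas x
  obtain ⟨K, hK, hxK, hKt⟩ := exists_compact_subset e.open_target
    (e.map_source (mem_chart_source _ x))
  have hmem : e.source ∩ e ⁻¹' interior K ∈ nhds x :=
    (e.isOpen_inter_preimage isOpen_interior).mem_nhds ⟨mem_chart_source _ x, hxK⟩
  refine ⟨_, hmem, ?_⟩
  rw [riemannianMeasure_apply_of_subset_source g he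
    (e.isOpen_inter_preimage isOpen_interior).measurableSet inter_subset_left]
  have hsub : e.target ∩ e.symm ⁻¹' (e.source ∩ e ⁻¹' interior K) ⊆ K := by
    rintro y ⟨hy, -, hyK⟩
    have h : e (e.symm y) ∈ interior K := hyK
    rw [e.right_inv hy] at h
    exact interior_subset h
  refine (lintegral_mono_set hsub).trans_lt ?_
  have hint : IntegrableOn (chartDensity g e) K :=
    ((contMDiffOn_chartDensity g he).continuousOn.mono hKt).integrableOn_compact hK
  exact hint.lintegral_lt_top

end Measure

/-! ### Change of variables under a local diffeomorphism. -/

section TransferDensity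

variable {d : ℕ} {M : Type*} [TopologicalSpace M]
  [ChartedSpace (EuclideanSpace ℝ (Fin d)) M] [IsManifold (𝓡 d) ∞ M]

theorem trans_mem_maximalAtlas {Φ : OpenPartialHomeomorph M M}
    (hΦ : ContMDiffOn (𝓡 d) (𝓡 d) ∞ Φ Φ.source)
    (hΦ' : ContMDiffOn (𝓡 d) (𝓡 d) ∞ Φ.symm Φ.target)
    {e : OpenPartialHomeomorph M (EuclideanSpace ℝ (Fin d))}
    (he : e ∈ IsManifold.maximalAtlas (𝓡 d) ∞ M) :
    Φ.trans e ∈ IsManifold.maximalAtlas (𝓡 d) ∞ M := by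
  refine (Φ.trans e).mem_maximalAtlas_of_contMDiffOn ?_ ?_
  · refine (contMDiffOn_of_mem_maximalAtlas he).comp (hΦ.mono ?_) ?_
    · intro x hx
      exact (by simpa using hx : x ∈ Φ.source ∧ Φ x ∈ e.source).1
    · intro x hx
      exact (by simpa using hx : x ∈ Φ.source ∧ Φ x ∈ e.source).2
  · refine hΦ'.comp ((contMDiffOn_symm_of_mem_maximalAtlas he).mono ?_) ?_
    · intro x hx
      exact (by simpa using hx : x ∈ e.target ∧ e.symm x ∈ Φ.target).1
    · intro x hx
      exact (by simpa using hx : x ∈ e.target ∧ e.symm x ∈ Φ.target).2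

/-- The density, with respect to the Riemannian measure, of the image under the diffeomorphism `Φ`
of the Riemannian measure on the domain of `Φ`. -/
def transferDensity (g : SmoothRiemannianMetric d M) (Φ : OpenPartialHomeomorph M M) (x : M) : ℝ :=
  chartDensity g (Φ.trans (chartAt (EuclideanSpace ℝ (Fin d)) x))
      (chartAt (EuclideanSpace ℝ (Fin d)) x x) /
    chartDensity g (chartAt (EuclideanSpace ℝ (Fin d)) x) (chartAt (EuclideanSpace ℝ (Fin d)) x x)

/-- A change of chart multiplies numerator and denominator by the same Jacobian, so any chart around
`x` computes the quotient. -/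
theorem transferDensity_eq (g : SmoothRiemannianMetric d M) {Φ : OpenPartialHomeomorph M M}
    (hΦ : ContMDiffOn (𝓡 d) (𝓡 d) ∞ Φ Φ.source)
    (hΦ' : ContMDiffOn (𝓡 d) (𝓡 d) ∞ Φ.symm Φ.target)
    {e : OpenPartialHomeomorph M (EuclideanSpace ℝ (Fin d))}
    (he : e ∈ IsManifold.maximalAtlas (𝓡 d) ∞ M) {x : M} (hx : x ∈ e.source)
    (hxΦ : x ∈ Φ.target) :
    transferDensity g Φ x = chartDensity g (Φ.trans e) (e x) / chartDensity g e (e x) := by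
  set e' := chartAt (EuclideanSpace ℝ (Fin d)) x with he'_def
  have he' : e' ∈ IsManifold.maximalAtlas (𝓡 d) ∞ M := IsManifold.chart_mem_maximalAtlas x
  have hx' : x ∈ e'.source := mem_chart_source _ x
  have hy : e x ∈ e.target := e.map_source hx
  have hyx : e.symm (e x) = x := e.left_inv hx
  have hy' : e.symm (e x) ∈ e'.source := by rwa [hyx]
  have hdiff := differentiableAt_transition he he' hy hy'
  have h1 := chartDensity_transition g he he' hy hy'
  have h2 : chartDensity g (Φ.trans e) (e x) = |(fderiv ℝ (e' ∘ e.symm) (e x)).det| *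
      chartDensity g (Φ.trans e') (e' (e.symm (e x))) := by
    refine chartDensity_comp g (ψ := e' ∘ e.symm) ?_ hdiff ?_
    · filter_upwards [(e.isOpen_inter_preimage_symm e'.open_source).mem_nhds ⟨hy, hy'⟩] with z hz
      have := e'.left_inv hz.2
      simp [this]
    · refine ((contMDiffOn_symm_of_mem_maximalAtlas
        (trans_mem_maximalAtlas hΦ hΦ' he')).mdifferentiableOn (by simp)).mdifferentiableAt
        ((Φ.trans e').open_target.mem_nhds ?_)
      simpa [hyx, e'.left_inv hx', hxΦ] using e'.map_source hx'
  have hpos : 0 < chartDensity g e (e x) := chartDensity_pos g he hy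
  rw [h1] at hpos
  rw [h1, h2, mul_div_mul_left _ _ (left_ne_zero_of_mul hpos.ne'), hyx, transferDensity]

theorem transferDensity_nonneg (g : SmoothRiemannianMetric d M) (Φ : OpenPartialHomeomorph M M)
    (x : M) : 0 ≤ transferDensity g Φ x :=
  div_nonneg (Real.sqrt_nonneg _) (Real.sqrt_nonneg _)

/-- The definition uses a chart that varies with the point. Chart independence allows one chart to
be fixed nearby, where the function is a quotient of smooth positive densities. -/
theorem contMDiffOn_transferDensity (g : SmoothRiemannianMetric d M)
    {Φ : OpenPartialHomeomorph M M} (hΦ : ContMDiffOn (𝓡 d) (𝓡 d) ∞ Φ Φ.source)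
    (hΦ' : ContMDiffOn (𝓡 d) (𝓡 d) ∞ Φ.symm Φ.target) :
    ContMDiffOn (𝓡 d) 𝓘(ℝ, ℝ) ∞ (transferDensity g Φ) Φ.target := by
  refine contMDiffOn_of_locally_contMDiffOn fun x hx => ?_
  set e := chartAt (EuclideanSpace ℝ (Fin d)) x
  have he : e ∈ IsManifold.maximalAtlas (𝓡 d) ∞ M := IsManifold.chart_mem_maximalAtlas x
  refine ⟨e.source, e.open_source, mem_chart_source _ x, ?_⟩
  have hE : ContMDiffOn (𝓡 d) (𝓡 d) ∞ e (Φ.target ∩ e.source) :=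
    (contMDiffOn_of_mem_maximalAtlas he).mono inter_subset_right
  have h1 : ContMDiffOn (𝓡 d) 𝓘(ℝ, ℝ) ∞ (fun z => chartDensity g (Φ.trans e) (e z))
      (Φ.target ∩ e.source) := by
    refine (contMDiffOn_chartDensity g (trans_mem_maximalAtlas hΦ hΦ' he)).comp hE fun z hz => ?_
    simpa [e.left_inv hz.2, hz.1] using e.map_source hz.2
  have h2 : ContMDiffOn (𝓡 d) 𝓘(ℝ, ℝ) ∞ (fun z => chartDensity g e (e z))
      (Φ.target ∩ e.source) :=
    (contMDiffOn_chartDensity g he).comp hE fun z hz => e.map_source hz.2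
  refine (h1.div₀ h2 fun z hz => (chartDensity_pos g he (e.map_source hz.2)).ne').congr
    fun z hz => transferDensity_eq g hΦ hΦ' he hz.2 hz.1

variable [MeasurableSpace M] [BorelSpace M]

theorem setLIntegral_riemannianMeasure (g : SmoothRiemannianMetric d M)
    {e : OpenPartialHomeomorph M (EuclideanSpace ℝ (Fin d))}
    (he : e ∈ IsManifold.maximalAtlas (𝓡 d) ∞ M) {A : Set M} (hA : MeasurableSet A)
    (hAe : A ⊆ e.source) {f : M → ℝ≥0∞}
    (hf : AEMeasurable f ((riemannianMeasure g).restrict A)) :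
    ∫⁻ x in A, f x ∂(riemannianMeasure g) = ∫⁻ y in e.target ∩ e.symm ⁻¹' A,
      ENNReal.ofReal (chartDensity g e y) * f (e.symm y) := by
  set ρ : EuclideanSpace ℝ (Fin d) → ℝ≥0∞ := fun y => ENNReal.ofReal (chartDensity g e y) with hρ
  set S := e.target ∩ e.symm ⁻¹' A with hS_def
  have hS : MeasurableSet S := measurableSet_chart_target_inter e hA
  have hρm : AEMeasurable ρ (volume.restrict S) :=
    (((contMDiffOn_chartDensity g he).continuousOn.mono inter_subset_left).aemeasurable
      hS).ennreal_ofReal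
  have hem : AEMeasurable e.symm ((volume.restrict S).withDensity ρ) :=
    ((e.continuousOn_symm.mono inter_subset_left).aemeasurable hS).mono_ac
      (withDensity_absolutelyContinuous _ _)
  have hmap : (riemannianMeasure g).restrict A =
      ((volume.restrict S).withDensity ρ).map e.symm := by
    ext B hB
    rw [Measure.restrict_apply hB, riemannianMeasure_apply_of_subset_source g he (hB.inter hA)
      (inter_subset_right.trans hAe), Measure.map_apply_of_aemeasurable hem hB, withDensity_apply',
      Measure.restrict_restrict' hS]
    congr 2
    ext y
    simp only [hS_def, mem_inter_iff, mem_preimage]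
    tauto
  rw [hmap] at hf ⊢
  rw [lintegral_map' hf hem]
  exact lintegral_withDensity_eq_lintegral_mul₀' hρm (hf.comp_aemeasurable hem)

/-- Countably many chart domains cover `M`, so it suffices to compare the measures inside one. There
the charts `Φ.trans e` on the domain and `e` on the image give the same coordinate set, and only the
densities differ. -/
theorem map_restrict_riemannianMeasure [SecondCountableTopology M]
    (g : SmoothRiemannianMetric d M) {Φ : OpenPartialHomeomorph M M}
    (hΦ : ContMDiffOn (𝓡 d) (𝓡 d) ∞ Φ Φ.source)
    (hΦ' : ContMDiffOn (𝓡 d) (𝓡 d) ∞ Φ.symm Φ.target) :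
    ((riemannianMeasure g).restrict Φ.source).map Φ =
      ((riemannianMeasure g).restrict Φ.target).withDensity
        fun x => ENNReal.ofReal (transferDensity g Φ x) := by
  obtain ⟨s, hsc, hs⟩ := TopologicalSpace.countable_cover_nhds
    (chart_source_mem_nhds (EuclideanSpace ℝ (Fin d)) (M := M))
  have hΦm : AEMeasurable Φ ((riemannianMeasure g).restrict Φ.source) :=
    Φ.continuousOn.aemeasurable Φ.open_source.measurableSet
  refine (Measure.ext_iff_of_biUnion_eq_univ hsc hs).2 fun x _ => ?_
  set e := chartAt (EuclideanSpace ℝ (Fin d)) x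
  have he : e ∈ IsManifold.maximalAtlas (𝓡 d) ∞ M := IsManifold.chart_mem_maximalAtlas x
  have heΦ := trans_mem_maximalAtlas hΦ hΦ' he
  ext B hB
  have hBe := hB.inter e.open_source.measurableSet
  set A : Set M := B ∩ e.source ∩ Φ.target with hA_def
  have hA : MeasurableSet A := hBe.inter Φ.open_target.measurableSet
  rw [Measure.restrict_apply hB, Measure.restrict_apply hB,
    Measure.map_apply_of_aemeasurable hΦm hBe,
    Measure.restrict_apply' Φ.open_source.measurableSet, withDensity_apply _ hBe,
    Measure.restrict_restrict' Φ.open_target.measurableSet, ← hA_def]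
  have hm : MeasurableSet (Φ ⁻¹' (B ∩ e.source) ∩ Φ.source) := by
    rw [inter_comm]
    exact measurableSet_inter_preimage_of_continuousOn Φ.continuousOn
      Φ.open_source.measurableSet hBe
  have hcont := (contMDiffOn_transferDensity g hΦ hΦ').continuousOn
  rw [riemannianMeasure_apply_of_subset_source g heΦ hm
      (by intro z hz; simpa using ⟨hz.2, hz.1.2⟩),
    setLIntegral_riemannianMeasure g he hA (inter_subset_left.trans inter_subset_right)
      ((hcont.mono inter_subset_right).aemeasurable hA).ennreal_ofReal]
  have hset : (Φ.trans e).target ∩ (Φ.trans e).symm ⁻¹' (Φ ⁻¹' (B ∩ e.source) ∩ Φ.source) =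
      e.target ∩ e.symm ⁻¹' A := by
    ext y
    simp only [OpenPartialHomeomorph.trans_target, OpenPartialHomeomorph.coe_trans_symm,
      mem_inter_iff, mem_preimage, Function.comp_apply, hA_def]
    constructor
    · rintro ⟨⟨h1, h2⟩, ⟨h3, h4⟩, h5⟩
      rw [Φ.right_inv h2] at h3 h4
      exact ⟨h1, ⟨h3, h4⟩, h2⟩
    · rintro ⟨h1, ⟨h3, h4⟩, h2⟩
      rw [Φ.right_inv h2]
      exact ⟨⟨h1, h2⟩, ⟨h3, h4⟩, Φ.map_target h2⟩
  rw [hset]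
  refine setLIntegral_congr_fun (measurableSet_chart_target_inter e hA) fun y hy => ?_
  have hye := e.map_target hy.1
  rw [transferDensity_eq g hΦ hΦ' he hye hy.2.2, e.right_inv hy.1,
    ← ENNReal.ofReal_mul (chartDensity_pos g he hy.1).le, mul_div_cancel₀]
  exact (chartDensity_pos g he hy.1).ne'

theorem setIntegral_comp_diffeomorph [SecondCountableTopology M]
    (g : SmoothRiemannianMetric d M) {Φ : OpenPartialHomeomorph M M}
    (hΦ : ContMDiffOn (𝓡 d) (𝓡 d) ∞ Φ Φ.source)
    (hΦ' : ContMDiffOn (𝓡 d) (𝓡 d) ∞ Φ.symm Φ.target) {F : M → ℝ}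
    (hF : ContinuousOn F Φ.target) :
    ∫ x in Φ.source, F (Φ x) ∂(riemannianMeasure g) =
      ∫ y in Φ.target, transferDensity g Φ y * F y ∂(riemannianMeasure g) := by
  have hmap := map_restrict_riemannianMeasure g hΦ hΦ'
  have hm := Φ.open_target.measurableSet
  have hJ : AEMeasurable (fun x => ENNReal.ofReal (transferDensity g Φ x))
      ((riemannianMeasure g).restrict Φ.target) :=
    ((contMDiffOn_transferDensity g hΦ hΦ').continuousOn.aemeasurable hm).ennreal_ofReal
  rw [← integral_map (Φ.continuousOn.aemeasurable Φ.open_source.measurableSet), hmap,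
    integral_withDensity_eq_integral_toReal_smul₀ hJ (by simp)]
  · simp [ENNReal.toReal_ofReal (transferDensity_nonneg g Φ _)]
  · rw [hmap]
    exact (hF.aestronglyMeasurable hm).mono_ac (withDensity_absolutelyContinuous _ _)

end TransferDensity

/-! ### Simple `H`-operators as bounded operators on `C₀(M)`. -/

section SimpleOperators

variable {M : Type*} [TopologicalSpace M]

theorem simpleHFun_of_mem {φ : M → ℝ} {Φ : OpenPartialHomeomorph M M} {f : M → ℝ} {x : M}
    (hx : x ∈ Φ.source) : simpleHFun φ Φ f x = φ x * f (Φ x) := by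
  simp [simpleHFun, hx]

theorem simpleHFun_of_notMem {φ : M → ℝ} {Φ : OpenPartialHomeomorph M M} {f : M → ℝ} {x : M}
    (hx : x ∉ Φ.source) : simpleHFun φ Φ f x = 0 := by
  simp [simpleHFun, hx]

theorem support_simpleHFun_subset (φ : M → ℝ) (Φ : OpenPartialHomeomorph M M) (f : M → ℝ) :
    Function.support (simpleHFun φ Φ f) ⊆ Function.support φ := by
  intro x hx hφ
  apply hx
  by_cases h : x ∈ Φ.source
  · rw [simpleHFun_of_mem h, hφ, zero_mul]
  · exact simpleHFun_of_notMem h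

theorem hasCompactSupport_simpleHFun {φ : M → ℝ} (hφ : HasCompactSupport φ)
    (Φ : OpenPartialHomeomorph M M) (f : M → ℝ) : HasCompactSupport (simpleHFun φ Φ f) :=
  hφ.of_isClosed_subset (isClosed_tsupport _)
    (closure_mono (support_simpleHFun_subset φ Φ f))

theorem continuous_simpleHFun {φ : M → ℝ} {Φ : OpenPartialHomeomorph M M} (hφ : Continuous φ)
    (hsupp : tsupport φ ⊆ Φ.source) {f : M → ℝ} (hf : Continuous f) :
    Continuous (simpleHFun φ Φ f) := by
  refine continuous_iff_continuousAt.2 fun x => ?_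
  by_cases hx : x ∈ Φ.source
  · have h : ContinuousAt (fun z => φ z * f (Φ z)) x :=
      hφ.continuousAt.mul (hf.continuousAt.comp (Φ.continuousAt hx))
    refine h.congr ?_
    filter_upwards [Φ.open_source.mem_nhds hx] with z hz
    exact (simpleHFun_of_mem hz).symm
  · have h : ContinuousAt (fun _ : M => (0 : ℝ)) x := continuousAt_const
    refine h.congr ?_
    -- A point outside the domain of `Φ` lies off the closed support of `φ`, so the extension by
    -- zero vanishes near it.
    filter_upwards [(isClosed_tsupport φ).isOpen_compl.mem_nhds fun h => hx (hsupp h)] with z hz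
    by_contra hne
    exact hz (subset_closure (support_simpleHFun_subset φ Φ f (Ne.symm hne)))

theorem exists_simpleHOperator {φ : M → ℝ} {Φ : OpenPartialHomeomorph M M} (hφ : Continuous φ)
    (hc : HasCompactSupport φ) (hsupp : tsupport φ ⊆ Φ.source) :
    ∃ T : C₀(M, ℝ) →L[ℝ] C₀(M, ℝ), ∀ (f : C₀(M, ℝ)) (x : M), T f x = simpleHFun φ Φ f x := by
  obtain ⟨C, hC⟩ := hc.exists_bound_of_continuous hφ
  let L : C₀(M, ℝ) →ₗ[ℝ] C₀(M, ℝ) :=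
    { toFun := fun f => ⟨⟨simpleHFun φ Φ f, continuous_simpleHFun hφ hsupp f.continuous⟩,
        (hasCompactSupport_simpleHFun hc Φ f).is_zero_at_infty⟩
      map_add' := fun f f' => by
        ext x
        change simpleHFun φ Φ (f + f' : C₀(M, ℝ)) x = simpleHFun φ Φ f x + simpleHFun φ Φ f' x
        by_cases h : x ∈ Φ.source
        · simp [simpleHFun_of_mem h, mul_add]
        · simp [simpleHFun_of_notMem h]
      map_smul' := fun c f => by
        ext x
        change simpleHFun φ Φ (c • f : C₀(M, ℝ)) x = c * simpleHFun φ Φ f x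
        by_cases h : x ∈ Φ.source
        · simp [simpleHFun_of_mem h]; ring
        · simp [simpleHFun_of_notMem h] }
  have hL : ∀ (f : C₀(M, ℝ)) (x : M), L f x = simpleHFun φ Φ f x := fun _ _ => rfl
  refine ⟨L.mkContinuous (max C 0) fun f => ?_, hL⟩
  rw [← ZeroAtInftyContinuousMap.norm_toBCF_eq_norm]
  refine (BoundedContinuousFunction.norm_le (by positivity)).2 fun x => ?_
  change ‖simpleHFun φ Φ f x‖ ≤ _
  by_cases h : x ∈ Φ.source
  · rw [simpleHFun_of_mem h, norm_mul]
    refine mul_le_mul ((hC x).trans (le_max_left _ _)) ?_ (norm_nonneg _) (le_max_right _ _)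
    rw [← ZeroAtInftyContinuousMap.norm_toBCF_eq_norm]
    exact f.toBCF.norm_coe_le_norm _
  · rw [simpleHFun_of_notMem h, norm_zero]
    positivity

end SimpleOperators

/-! ### The adjoint of an `H`-operator on `C₀(M)`. -/

section Adjoint

variable {d : ℕ} {M : Type*} [TopologicalSpace M]
  [ChartedSpace (EuclideanSpace ℝ (Fin d)) M]

/-- Provides integrability of all pairings and membership of `T f` in every `L^p`, even when `f`
itself is in none of them. -/
theorem hasCompactSupport_of_mem_localizedHOperators {U : Set M}
    {T : C₀(M, ℝ) →L[ℝ] C₀(M, ℝ)} (hT : T ∈ localizedHOperators d U) (f : C₀(M, ℝ)) :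
    HasCompactSupport (T f) := by
  induction hT using Submodule.span_induction with
  | mem T hT =>
    obtain ⟨φ, Φ, -, -, -, hc, -, -, -, h⟩ := hT
    rw [funext (h f)]
    exact hasCompactSupport_simpleHFun hc Φ f
  | zero => exact HasCompactSupport.zero
  | add S T _ _ hS hT => exact hS.add hT
  | smul c T _ hT => exact hT.smul_left (f := fun _ => c)

/-- The weight of the adjoint of `H_{φ,Φ,V}`. -/
def adjointWeight [IsManifold (𝓡 d) ∞ M] (g : SmoothRiemannianMetric d M)
    (φ : M → ℝ) (Φ : OpenPartialHomeomorph M M) : M → ℝ :=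
  simpleHFun (transferDensity g Φ) Φ.symm φ

section Weight

variable [IsManifold (𝓡 d) ∞ M]

theorem support_adjointWeight_subset (g : SmoothRiemannianMetric d M)
    (φ : M → ℝ) (Φ : OpenPartialHomeomorph M M) :
    Function.support (adjointWeight g φ Φ) ⊆ Φ '' (Φ.source ∩ tsupport φ) := by
  intro y hy
  by_cases h : y ∈ Φ.target
  · have h' : y ∈ Φ.symm.source := h
    rw [Function.mem_support, adjointWeight, simpleHFun_of_mem h'] at hy
    exact ⟨Φ.symm y, ⟨Φ.map_target h, subset_closure (right_ne_zero_of_mul hy)⟩, Φ.right_inv h⟩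
  · exact absurd (simpleHFun_of_notMem (Φ := Φ.symm) h) hy

theorem isCompact_image_tsupport {φ : M → ℝ} {Φ : OpenPartialHomeomorph M M}
    (hc : HasCompactSupport φ) (hsupp : tsupport φ ⊆ Φ.source) :
    IsCompact (Φ '' (Φ.source ∩ tsupport φ)) := by
  rw [inter_eq_right.2 hsupp]
  exact IsCompact.image_of_continuousOn hc (Φ.continuousOn.mono hsupp)

variable [T2Space M]

theorem tsupport_adjointWeight_subset (g : SmoothRiemannianMetric d M) {φ : M → ℝ}
    {Φ : OpenPartialHomeomorph M M} (hc : HasCompactSupport φ) (hsupp : tsupport φ ⊆ Φ.source) :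
    tsupport (adjointWeight g φ Φ) ⊆ Φ '' (Φ.source ∩ tsupport φ) :=
  closure_minimal (support_adjointWeight_subset g φ Φ) (isCompact_image_tsupport hc hsupp).isClosed

/-- `transferDensity` is known to be smooth only on `Φ.target`, but the weight is supported in the
compact set `Φ(supp φ)` inside it, so smoothness need be checked only there. -/
theorem contMDiff_adjointWeight (g : SmoothRiemannianMetric d M) {φ : M → ℝ}
    {Φ : OpenPartialHomeomorph M M} (hΦ : ContMDiffOn (𝓡 d) (𝓡 d) ∞ Φ Φ.source)
    (hΦ' : ContMDiffOn (𝓡 d) (𝓡 d) ∞ Φ.symm Φ.target) (hφ : ContMDiff (𝓡 d) 𝓘(ℝ, ℝ) ∞ φ)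
    (hc : HasCompactSupport φ) (hsupp : tsupport φ ⊆ Φ.source) :
    ContMDiff (𝓡 d) 𝓘(ℝ, ℝ) ∞ (adjointWeight g φ Φ) := by
  refine contMDiff_of_tsupport fun y hy => ?_
  have hyt : y ∈ Φ.target := by
    obtain ⟨x, hx, rfl⟩ := tsupport_adjointWeight_subset g hc hsupp hy
    exact Φ.map_source hx.1
  have h : ContMDiffOn (𝓡 d) 𝓘(ℝ, ℝ) ∞ (fun z => transferDensity g Φ z * φ (Φ.symm z)) Φ.target :=
    (contMDiffOn_transferDensity g hΦ hΦ').mul (hφ.comp_contMDiffOn hΦ')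
  refine (h.contMDiffAt (Φ.open_target.mem_nhds hyt)).congr_of_eventuallyEq ?_
  filter_upwards [Φ.open_target.mem_nhds hyt] with z hz
  exact simpleHFun_of_mem (Φ := Φ.symm) hz

end Weight

variable [IsManifold (𝓡 d) ∞ M] [SecondCountableTopology M] [MeasurableSpace M]
  [BorelSpace M]

theorem integral_simpleHFun_mul (g : SmoothRiemannianMetric d M) {φ : M → ℝ}
    {Φ : OpenPartialHomeomorph M M} (hΦ : ContMDiffOn (𝓡 d) (𝓡 d) ∞ Φ Φ.source)
    (hΦ' : ContMDiffOn (𝓡 d) (𝓡 d) ∞ Φ.symm Φ.target) (hφ : Continuous φ)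
    {f h : M → ℝ} (hf : Continuous f) (hh : Continuous h) :
    ∫ x, simpleHFun φ Φ f x * h x ∂(riemannianMeasure g) =
      ∫ x, f x * simpleHFun (adjointWeight g φ Φ) Φ.symm h x ∂(riemannianMeasure g) := by
  have hF : ContinuousOn (fun y => φ (Φ.symm y) * f y * h (Φ.symm y)) Φ.target :=
    ((hφ.comp_continuousOn Φ.continuousOn_symm).mul hf.continuousOn).mul
      (hh.comp_continuousOn Φ.continuousOn_symm)
  have h1 := setIntegral_comp_diffeomorph g hΦ hΦ' hF
  rw [← setIntegral_eq_integral_of_forall_compl_eq_zero (s := Φ.source)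
      (fun x hx => by rw [simpleHFun_of_notMem hx, zero_mul]),
    ← setIntegral_eq_integral_of_forall_compl_eq_zero (s := Φ.target)
      (f := fun x => f x * simpleHFun (adjointWeight g φ Φ) Φ.symm h x)
      (fun x hx => by rw [simpleHFun_of_notMem (Φ := Φ.symm) hx, mul_zero])]
  -- Writing `x` as `Φ.symm (Φ x)` turns the integrand into a function of `Φ x`, as the substitution
  -- requires.
  rw [setIntegral_congr_fun Φ.open_source.measurableSet
      (g := fun x => φ (Φ.symm (Φ x)) * f (Φ x) * h (Φ.symm (Φ x))), h1]
  · refine setIntegral_congr_fun Φ.open_target.measurableSet fun y hy => ?_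
    have hy' : y ∈ Φ.symm.source := hy
    simp only [simpleHFun_of_mem hy', adjointWeight]
    ring
  · intro x hx
    simp only [simpleHFun_of_mem hx, Φ.left_inv hx]

theorem exists_adjoint_mem_localizedHOperators [T2Space M] (g : SmoothRiemannianMetric d M)
    {U : Set M}
    {T : C₀(M, ℝ) →L[ℝ] C₀(M, ℝ)} (hT : T ∈ localizedHOperators d U) :
    ∃ T' ∈ localizedHOperators d U, ∀ f h : C₀(M, ℝ),
      ∫ x, T f x * h x ∂(riemannianMeasure g) = ∫ x, f x * T' h x ∂(riemannianMeasure g) := by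
  have hint1 : ∀ S ∈ localizedHOperators d U, ∀ f h : C₀(M, ℝ),
      Integrable (fun x => S f x * h x) (riemannianMeasure g) := fun S hS f h =>
    ((S f).continuous.mul h.continuous).integrable_of_hasCompactSupport
      (hasCompactSupport_of_mem_localizedHOperators hS f).mul_right
  have hint2 : ∀ S ∈ localizedHOperators d U, ∀ f h : C₀(M, ℝ),
      Integrable (fun x => f x * S h x) (riemannianMeasure g) := fun S hS f h => by
    simpa only [mul_comm] using hint1 S hS h f
  induction hT using Submodule.span_induction with
  | mem T hT =>
    obtain ⟨φ, Φ, hΦ, hΦ', hφ, hc, hsupp, hsU, htU, h⟩ := hT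
    have hw := contMDiff_adjointWeight g hΦ hΦ' hφ hc hsupp
    have hK := tsupport_adjointWeight_subset g hc hsupp
    have hwc : HasCompactSupport (adjointWeight g φ Φ) :=
      (isCompact_image_tsupport hc hsupp).of_isClosed_subset (isClosed_tsupport _) hK
    have hws : tsupport (adjointWeight g φ Φ) ⊆ Φ.symm.source := by
      refine hK.trans ?_
      rintro _ ⟨x, hx, rfl⟩
      exact Φ.map_source hx.1
    obtain ⟨T', hT'⟩ := exists_simpleHOperator hw.continuous hwc hws
    refine ⟨T', Submodule.subset_span ⟨adjointWeight g φ Φ, Φ.symm, hΦ', by simpa using hΦ, hw,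
      hwc, hws, htU, hsU, hT'⟩, fun f k => ?_⟩
    simp only [h, hT']
    exact integral_simpleHFun_mul g hΦ hΦ' hφ.continuous f.continuous k.continuous
  | zero => exact ⟨0, Submodule.zero_mem _, fun f h => by simp⟩
  | add S T hS hT ihS ihT =>
    obtain ⟨S', hS', h1⟩ := ihS
    obtain ⟨T', hT', h2⟩ := ihT
    refine ⟨S' + T', Submodule.add_mem _ hS' hT', fun f h => ?_⟩
    have e1 : ∀ x, (S + T) f x * h x = S f x * h x + T f x * h x := fun x => by simp [add_mul]
    have e2 : ∀ x, f x * (S' + T') h x = f x * S' h x + f x * T' h x := fun x => by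
      simp [mul_add]
    simp only [e1, e2]
    rw [integral_add (hint1 S hS f h) (hint1 T hT f h),
      integral_add (hint2 S' hS' f h) (hint2 T' hT' f h), h1, h2]
  | smul c T _ ih =>
    obtain ⟨T', hT', h1⟩ := ih
    refine ⟨c • T', Submodule.smul_mem _ c hT', fun f h => ?_⟩
    have e1 : ∀ x, (c • T) f x * h x = c * (T f x * h x) := fun x => by simp [mul_assoc]
    have e2 : ∀ x, f x * (c • T') h x = c * (f x * T' h x) := fun x => by simp; ring
    simp only [e1, e2, integral_const_mul, h1]

end Adjoint

/-! ### Abstract duality for a pairing with norming elements. -/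

section Duality

variable {E F ι : Type*} [NormedAddCommGroup E] [NormedSpace ℝ E] [NormedAddCommGroup F]
  [NormedSpace ℝ F] {B : E →L[ℝ] F →L[ℝ] ℝ} {r s : ℝ}

theorem eq_of_forall_pairing_eq (hs : s ≠ 0)
    (hN : ∀ h : F, ∃ f : E, B f h = ‖h‖ ^ s ∧ ‖f‖ ^ r = ‖h‖ ^ s) {k k' : F}
    (h : ∀ f, B f k = B f k') : k = k' := by
  obtain ⟨f, hf, -⟩ := hN (k - k')
  rw [map_sub, h f, sub_self, eq_comm, Real.rpow_eq_zero (norm_nonneg _) hs] at hf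
  exact sub_eq_zero.1 (norm_eq_zero.1 hf)

theorem norm_eq_rpow_of_rpow_eq (hrs : r.HolderConjugate s) {a b : ℝ} (ha : 0 ≤ a) (hb : 0 ≤ b)
    (h : a ^ r = b ^ s) : a = b ^ (s - 1) := by
  have h1 : (a ^ r) ^ r⁻¹ = a := Real.rpow_rpow_inv ha hrs.ne_zero
  rw [← h1, h, ← Real.rpow_mul hb]
  congr 1
  rw [← div_eq_mul_inv]
  exact hrs.symm.div_conj_eq_sub_one

/-- Testing against `f` norming `k` gives `‖k‖ ^ s ≤ ‖P‖ * ‖h‖ * ‖k‖ ^ (s - 1)`. It concerns a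
single pair `h`, `k`, so it applies before the adjoint is defined everywhere. -/
theorem norm_le_of_pairing_eq (hrs : r.HolderConjugate s)
    (hB : ∀ f h, B f h ≤ ‖f‖ * ‖h‖)
    (hN : ∀ h : F, ∃ f : E, B f h = ‖h‖ ^ s ∧ ‖f‖ ^ r = ‖h‖ ^ s) {P : E →L[ℝ] E} {h k : F}
    (hk : ∀ f, B f k = B (P f) h) : ‖k‖ ≤ ‖P‖ * ‖h‖ := by
  obtain ⟨f, hf, hf'⟩ := hN k
  have hfn := norm_eq_rpow_of_rpow_eq hrs (norm_nonneg f) (norm_nonneg k) hf'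
  rcases eq_or_ne k 0 with rfl | hk0
  · simpa using by positivity
  have hkpos : 0 < ‖k‖ := norm_pos_iff.2 hk0
  have h1 : ‖k‖ ^ s ≤ ‖P‖ * ‖h‖ * ‖k‖ ^ (s - 1) := by
    rw [← hf, hk f, ← hfn]
    calc B (P f) h ≤ ‖P f‖ * ‖h‖ := hB _ _
      _ ≤ ‖P‖ * ‖f‖ * ‖h‖ := by gcongr; exact P.le_opNorm f
      _ = _ := by ring
  rw [Real.rpow_sub_one hkpos.ne', mul_div_assoc', le_div_iff₀ hkpos] at h1
  have h2 : ‖k‖ ^ s * ‖k‖ ≤ ‖k‖ ^ s * (‖P‖ * ‖h‖) := by linarith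
  exact le_of_mul_le_mul_left h2 (Real.rpow_pos_of_pos hkpos s)

/-- The vectors at which an adjoint value exists form a closed set: by the norm estimate the values
along a convergent sequence are Cauchy. Hence a dense supply of explicit values suffices, with no
representation theorem for functionals. -/
theorem exists_adjoint_of_dense [CompleteSpace F] (hrs : r.HolderConjugate s)
    (hB : ∀ f h, B f h ≤ ‖f‖ * ‖h‖)
    (hN : ∀ h : F, ∃ f : E, B f h = ‖h‖ ^ s ∧ ‖f‖ ^ r = ‖h‖ ^ s) (P : E →L[ℝ] E)
    (hd : Dense {h : F | ∃ k : F, ∀ f, B f k = B (P f) h}) :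
    ∃ Q : F →L[ℝ] F, ∀ f h, B (P f) h = B f (Q h) := by
  have hex : ∀ h : F, ∃ k : F, ∀ f, B f k = B (P f) h := by
    intro h
    obtain ⟨u, hu, hul⟩ := mem_closure_iff_seq_limit.1 (hd h)
    choose k hk using hu
    have hcauchy : CauchySeq k := by
      have hu := hul.cauchySeq
      rw [Metric.cauchySeq_iff'] at hu ⊢
      intro ε hε
      -- The summand `1` covers the case `P = 0`.
      obtain ⟨N, hN'⟩ := hu (ε / (‖P‖ + 1)) (by positivity)
      refine ⟨N, fun n hn => ?_⟩
      have h1 : ‖k n - k N‖ ≤ ‖P‖ * ‖u n - u N‖ :=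
        norm_le_of_pairing_eq hrs hB hN fun f => by simp [hk]
      have h2 := hN' n hn
      rw [dist_eq_norm] at h2 ⊢
      rw [lt_div_iff₀ (by positivity)] at h2
      nlinarith [norm_nonneg (u n - u N)]
    obtain ⟨k', hk'⟩ := cauchySeq_tendsto_of_complete hcauchy
    refine ⟨k', fun f => ?_⟩
    refine tendsto_nhds_unique (((B f).continuous.tendsto k').comp hk') ?_
    have : (⇑(B f) ∘ k) = (⇑(B (P f)) ∘ u) := funext fun n => hk n f
    rw [this]
    exact ((B (P f)).continuous.tendsto h).comp hul
  choose Q hQ using hex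
  have huniq : ∀ {k k' : F}, (∀ f, B f k = B f k') → k = k' :=
    fun h => eq_of_forall_pairing_eq hrs.symm.ne_zero hN h
  let L : F →ₗ[ℝ] F :=
    { toFun := Q
      map_add' := fun x y => huniq fun f => by simp [hQ]
      map_smul' := fun c x => huniq fun f => by simp [hQ] }
  exact ⟨L.mkContinuous ‖P‖ fun h => norm_le_of_pairing_eq hrs hB hN (hQ h),
    fun f h => (hQ h f).symm⟩

/-! ### Transfer of the decomposition properties to the adjoint family. -/

section Decomposition

variable {P : ι → E →L[ℝ] E} {Q : ι → F →L[ℝ] F} {C : ℝ}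

theorem comp_adjoint_eq {i j k : ι} (hs : s ≠ 0)
    (hN : ∀ h : F, ∃ f : E, B f h = ‖h‖ ^ s ∧ ‖f‖ ^ r = ‖h‖ ^ s)
    (hPQ : ∀ i f h, B (P i f) h = B f (Q i h)) (h : (P j).comp (P i) = P k) :
    (Q i).comp (Q j) = Q k := by
  ext x
  refine eq_of_forall_pairing_eq (B := B) hs hN fun f => ?_
  rw [ContinuousLinearMap.comp_apply, ← hPQ, ← hPQ, ← hPQ, ← h]
  rfl

theorem adjoint_comp_eq_zero {i j : ι} (hs : s ≠ 0)
    (hN : ∀ h : F, ∃ f : E, B f h = ‖h‖ ^ s ∧ ‖f‖ ^ r = ‖h‖ ^ s)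
    (hPQ : ∀ i f h, B (P i f) h = B f (Q i h)) (h : (P j).comp (P i) = 0) :
    (Q i).comp (Q j) = 0 := by
  ext x
  refine eq_of_forall_pairing_eq (B := B) hs hN fun f => ?_
  rw [ContinuousLinearMap.comp_apply, ← hPQ, ← hPQ, ← ContinuousLinearMap.comp_apply (P j), h]
  simp

/-- The two-sided bound of a decomposition constant, for operators on a normed space. -/
def HasDecompositionBound (P : ι → E →L[ℝ] E) (r C : ℝ) : Prop :=
  0 < C ∧ ∀ f : E, Summable (fun i => ‖P i f‖ ^ r) ∧
    1 / C * ‖f‖ ≤ (∑' i, ‖P i f‖ ^ r) ^ (1 / r) ∧ (∑' i, ‖P i f‖ ^ r) ^ (1 / r) ≤ C * ‖f‖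

theorem HasDecompositionBound.norm_apply_le (h : HasDecompositionBound P r C) (hr : 0 < r) (i : ι)
    (f : E) : ‖P i f‖ ≤ C * ‖f‖ := by
  obtain ⟨hsum, -, hle⟩ := h.2 f
  refine le_trans ?_ hle
  calc ‖P i f‖ = (‖P i f‖ ^ r) ^ (1 / r) := by
        rw [one_div, Real.rpow_rpow_inv (norm_nonneg _) hr.ne']
    _ ≤ _ := Real.rpow_le_rpow (by positivity)
        (hsum.le_tsum i fun j _ => by positivity) (by positivity)

theorem apply_sum_of_orthogonal {G : Type*} [NormedAddCommGroup G] [NormedSpace ℝ G]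
    [DecidableEq ι] {P : ι → G →L[ℝ] G} (hproj : ∀ i, (P i).comp (P i) = P i)
    (horth : ∀ i j, i ≠ j → (P i).comp (P j) = 0) (t : Finset ι) (f : ι → G) (j : ι) :
    P j (∑ i ∈ t, P i (f i)) = if j ∈ t then P j (f j) else 0 := by
  have h : ∀ i, P j (P i (f i)) = if j = i then P j (f j) else 0 := fun i => by
    rw [← ContinuousLinearMap.comp_apply]
    split_ifs with hji
    · rw [← hji, hproj]
    · rw [horth j i hji, _root_.zero_apply]
  simp [map_sum, h]

theorem tsum_norm_apply_sum_of_orthogonal {G : Type*} [NormedAddCommGroup G] [NormedSpace ℝ G]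
    {P : ι → G →L[ℝ] G} (hr : r ≠ 0) (hproj : ∀ i, (P i).comp (P i) = P i)
    (horth : ∀ i j, i ≠ j → (P i).comp (P j) = 0) (t : Finset ι) (f : ι → G) :
    ∑' j, ‖P j (∑ i ∈ t, P i (f i))‖ ^ r = ∑ j ∈ t, ‖P j (f j)‖ ^ r := by
  classical
  rw [tsum_eq_sum (s := t)]
  · refine Finset.sum_congr rfl fun j hj => ?_
    rw [apply_sum_of_orthogonal hproj horth, if_pos hj]
  · intro j hj
    rw [apply_sum_of_orthogonal hproj horth, if_neg hj, norm_zero, Real.zero_rpow hr]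

/-- Orthogonality makes the components of the finite sum exactly the terms `P i (f i)`, so the lower
decomposition bound applied to the sum becomes an upper estimate of its norm. -/
theorem HasDecompositionBound.norm_sum_le {G : Type*} [NormedAddCommGroup G] [NormedSpace ℝ G]
    {P : ι → G →L[ℝ] G} (h : HasDecompositionBound P r C) (hr : r ≠ 0)
    (hproj : ∀ i, (P i).comp (P i) = P i)
    (horth : ∀ i j, i ≠ j → (P i).comp (P j) = 0) (t : Finset ι) (f : ι → G) :
    ‖∑ i ∈ t, P i (f i)‖ ≤ C * (∑ i ∈ t, ‖P i (f i)‖ ^ r) ^ (1 / r) := by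
  obtain ⟨-, hle, -⟩ := h.2 (∑ i ∈ t, P i (f i))
  rw [tsum_norm_apply_sum_of_orthogonal hr hproj horth, one_div_mul_eq_div, div_le_iff₀ h.1] at hle
  linarith

/-- With `f i` norming `Q i h`, the sum `S` equals the pairing of `∑ P i (f i)` with `h`. One factor
`C` comes from `norm_sum_le`, the other from `‖P i (f i)‖ ≤ C * ‖f i‖`; this gives `S ≤ C ^ 2 * S ^
(1 / r) * ‖h‖`, and dividing by `S ^ (1 / r)` finishes. -/
theorem sum_norm_adjoint_le (hrs : r.HolderConjugate s) (hB : ∀ f h, B f h ≤ ‖f‖ * ‖h‖)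
    (hN : ∀ h : F, ∃ f : E, B f h = ‖h‖ ^ s ∧ ‖f‖ ^ r = ‖h‖ ^ s)
    (hPQ : ∀ i f h, B (P i f) h = B f (Q i h)) (hproj : ∀ i, (P i).comp (P i) = P i)
    (horth : ∀ i j, i ≠ j → (P i).comp (P j) = 0) (hC : HasDecompositionBound P r C)
    (t : Finset ι) (h : F) :
    (∑ i ∈ t, ‖Q i h‖ ^ s) ^ (1 / s) ≤ C ^ 2 * ‖h‖ := by
  have hC0 := hC.1
  choose f hf hf' using fun i => hN (Q i h)
  set S := ∑ i ∈ t, ‖Q i h‖ ^ s with hS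
  have hS0 : 0 ≤ S := Finset.sum_nonneg fun i _ => by positivity
  rcases hS0.eq_or_lt with h0 | hSpos
  · rw [← h0, Real.zero_rpow (one_div_ne_zero hrs.symm.ne_zero)]
    positivity
  have h1 : S ≤ ‖∑ i ∈ t, P i (f i)‖ * ‖h‖ := by
    refine le_trans (le_of_eq ?_) (hB _ _)
    rw [map_sum, FunLike.coe_sum, Finset.sum_apply]
    exact Finset.sum_congr rfl fun i _ => by rw [hPQ, hf]
  have h2 : ‖∑ i ∈ t, P i (f i)‖ ≤ C * (C * S ^ (1 / r)) := by
    refine (hC.norm_sum_le hrs.ne_zero hproj horth t f).trans ?_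
    gcongr
    have : ∑ i ∈ t, ‖P i (f i)‖ ^ r ≤ C ^ r * S := by
      rw [hS, Finset.mul_sum]
      refine Finset.sum_le_sum fun i _ => ?_
      rw [← hf' i, ← Real.mul_rpow hC0.le (norm_nonneg _)]
      exact Real.rpow_le_rpow (norm_nonneg _) (hC.norm_apply_le hrs.pos i _) hrs.nonneg
    calc (∑ i ∈ t, ‖P i (f i)‖ ^ r) ^ (1 / r) ≤ (C ^ r * S) ^ (1 / r) :=
          Real.rpow_le_rpow (Finset.sum_nonneg fun i _ => by positivity) this
            (by have := hrs.pos; positivity)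
      _ = C * S ^ (1 / r) := by
          rw [Real.mul_rpow (by positivity) hS0, one_div, Real.rpow_rpow_inv hC0.le hrs.ne_zero]
  have h3 : S ^ (1 / r) * S ^ (1 / s) = S := by
    rw [← Real.rpow_add hSpos, one_div, one_div, hrs.inv_add_inv_eq_one, Real.rpow_one]
  have h4 : S ^ (1 / r) * S ^ (1 / s) ≤ S ^ (1 / r) * (C ^ 2 * ‖h‖) := by
    rw [h3]
    calc S ≤ ‖∑ i ∈ t, P i (f i)‖ * ‖h‖ := h1
      _ ≤ C * (C * S ^ (1 / r)) * ‖h‖ := by gcongr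
      _ = _ := by ring
  exact le_of_mul_le_mul_left h4 (Real.rpow_pos_of_pos hSpos _)

theorem norm_le_tsum_adjoint (hrs : r.HolderConjugate s) (hB : ∀ f h, B f h ≤ ‖f‖ * ‖h‖)
    (hN : ∀ h : F, ∃ f : E, B f h = ‖h‖ ^ s ∧ ‖f‖ ^ r = ‖h‖ ^ s)
    (hPQ : ∀ i f h, B (P i f) h = B f (Q i h)) (hproj : ∀ i, (P i).comp (P i) = P i)
    (hsum : ∀ f, HasSum (fun i => P i f) f) (hC : HasDecompositionBound P r C) {h : F}
    (hQ : Summable fun i => ‖Q i h‖ ^ s) :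
    ‖h‖ ≤ C * (∑' i, ‖Q i h‖ ^ s) ^ (1 / s) := by
  have hC0 := hC.1
  set T := (∑' i, ‖Q i h‖ ^ s) ^ (1 / s) with hT
  have hT0 : 0 ≤ T := Real.rpow_nonneg (tsum_nonneg fun i => by positivity) _
  rcases eq_or_ne h 0 with rfl | hh0
  · rw [norm_zero]; positivity
  have hpos : 0 < ‖h‖ := norm_pos_iff.2 hh0
  obtain ⟨f, hf, hf'⟩ := hN h
  have hfn := norm_eq_rpow_of_rpow_eq hrs (norm_nonneg f) (norm_nonneg h) hf'
  have h1 : HasSum (fun i => B (P i f) h) (B f h) :=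
    (hsum f).mapL (B.flip h)
  have h2 : ∀ i, B (P i f) h ≤ ‖P i f‖ * ‖Q i h‖ := fun i => by
    -- Idempotence lets one copy of `P i` pass to `h` as `Q i` while the other stays on `f`, so both
    -- factors in Hölder's inequality are components.
    have : P i f = P i (P i f) := by rw [← ContinuousLinearMap.comp_apply, hproj]
    rw [this, hPQ, ← this]
    exact hB _ _
  obtain ⟨h3, h4⟩ := Real.summable_and_inner_le_Lp_mul_Lq_tsum_of_nonneg hrs
    (fun i => norm_nonneg (P i f)) (fun i => norm_nonneg (Q i h)) (hC.2 f).1 hQ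
  have h5 : ‖h‖ ^ s ≤ C * ‖h‖ ^ (s - 1) * T := by
    rw [← hf, ← h1.tsum_eq, ← hfn]
    refine (h1.summable.tsum_le_tsum h2 h3).trans (h4.trans ?_)
    exact mul_le_mul_of_nonneg_right (hC.2 f).2.2 hT0
  rw [Real.rpow_sub_one hpos.ne', mul_div_assoc', div_mul_eq_mul_div, le_div_iff₀ hpos] at h5
  have h6 : ‖h‖ ^ s * ‖h‖ ≤ ‖h‖ ^ s * (C * T) := by linarith
  exact le_of_mul_le_mul_left h6 (Real.rpow_pos_of_pos hpos s)

/-- The lower bound costs `C` and the upper bound `C ^ 2`; the maximum serves both and is `1` when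
`C = 1`. -/
theorem hasDecompositionBound_adjoint (hrs : r.HolderConjugate s)
    (hB : ∀ f h, B f h ≤ ‖f‖ * ‖h‖)
    (hN : ∀ h : F, ∃ f : E, B f h = ‖h‖ ^ s ∧ ‖f‖ ^ r = ‖h‖ ^ s)
    (hPQ : ∀ i f h, B (P i f) h = B f (Q i h)) (hproj : ∀ i, (P i).comp (P i) = P i)
    (horth : ∀ i j, i ≠ j → (P i).comp (P j) = 0)
    (hsum : ∀ f, HasSum (fun i => P i f) f) (hC : HasDecompositionBound P r C) :
    HasDecompositionBound Q s (max C (C ^ 2)) := by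
  have hC0 := hC.1
  have hD : 0 < max C (C ^ 2) := lt_max_of_lt_left hC0
  have hs := hrs.symm.pos
  refine ⟨hD, fun h => ?_⟩
  have hfin : ∀ t : Finset ι, ∑ i ∈ t, ‖Q i h‖ ^ s ≤ (C ^ 2 * ‖h‖) ^ s := fun t => by
    have h1 := sum_norm_adjoint_le hrs hB hN hPQ hproj horth hC t h
    rw [one_div] at h1
    exact (Real.rpow_inv_le_iff_of_pos (Finset.sum_nonneg fun i _ => by positivity)
      (by positivity) hs).1 h1
  have hS : Summable fun i => ‖Q i h‖ ^ s :=
    summable_of_sum_le (fun i => by positivity) hfin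
  refine ⟨hS, ?_, ?_⟩
  · have h1 := norm_le_tsum_adjoint hrs hB hN hPQ hproj hsum hC hS
    rw [one_div_mul_eq_div, div_le_iff₀ hD, mul_comm]
    exact h1.trans (mul_le_mul_of_nonneg_right (le_max_left _ _)
      (Real.rpow_nonneg (tsum_nonneg fun i => by positivity) _))
  · rw [one_div, Real.rpow_inv_le_iff_of_pos (tsum_nonneg fun i => by positivity)
      (by positivity) hs]
    refine (hS.tsum_le_of_sum_le hfin).trans (Real.rpow_le_rpow (by positivity) ?_ hs.le)
    gcongr
    exact le_max_right _ _

/-- Cauchy criterion: `norm_sum_le` bounds finite blocks of the series by blocks of the convergent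
series of `s`-th powers. -/
theorem summable_of_hasDecompositionBound {G : Type*} [NormedAddCommGroup G] [NormedSpace ℝ G]
    [CompleteSpace G] {Q : ι → G →L[ℝ] G} (hs : 0 < s) (hproj : ∀ i, (Q i).comp (Q i) = Q i)
    (horth : ∀ i j, i ≠ j → (Q i).comp (Q j) = 0) (hC : HasDecompositionBound Q s C) (h : G) :
    Summable fun i => Q i h := by
  have hC0 := hC.1
  rw [summable_iff_vanishing_norm]
  intro ε hε
  obtain ⟨t, ht⟩ := summable_iff_vanishing_norm.1 (hC.2 h).1 ((ε / C) ^ s) (by positivity)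
  refine ⟨t, fun t' ht' => ?_⟩
  have hnn : 0 ≤ ∑ i ∈ t', ‖Q i h‖ ^ s := Finset.sum_nonneg fun i _ => by positivity
  have h1 := ht t' ht'
  rw [Real.norm_of_nonneg hnn] at h1
  have h2 := Real.rpow_lt_rpow hnn h1 (inv_pos.2 hs)
  rw [Real.rpow_rpow_inv (by positivity) hs.ne', lt_div_iff₀ hC0] at h2
  have h3 := hC.norm_sum_le hs.ne' hproj horth t' fun _ => h
  rw [one_div] at h3
  linarith

theorem hasSum_adjoint [CompleteSpace F] (hrs : r.HolderConjugate s)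
    (hB : ∀ f h, B f h ≤ ‖f‖ * ‖h‖)
    (hN : ∀ h : F, ∃ f : E, B f h = ‖h‖ ^ s ∧ ‖f‖ ^ r = ‖h‖ ^ s)
    (hPQ : ∀ i f h, B (P i f) h = B f (Q i h)) (hproj : ∀ i, (P i).comp (P i) = P i)
    (horth : ∀ i j, i ≠ j → (P i).comp (P j) = 0)
    (hsum : ∀ f, HasSum (fun i => P i f) f) (hC : HasDecompositionBound P r C) (h : F) :
    HasSum (fun i => Q i h) h := by
  have hs := hrs.symm.ne_zero
  have hS : Summable fun i => Q i h := summable_of_hasDecompositionBound hrs.symm.pos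
    (fun i => comp_adjoint_eq hs hN hPQ (hproj i))
    (fun i j hij => adjoint_comp_eq_zero hs hN hPQ (horth j i hij.symm))
    (hasDecompositionBound_adjoint hrs hB hN hPQ hproj horth hsum hC) h
  convert hS.hasSum
  -- Against any `f`, both `h` and the sum pair to `∑ B (P i f) h`.
  refine eq_of_forall_pairing_eq (B := B) hs hN fun f => ?_
  have h1 : HasSum (fun i => B (P i f) h) (B f h) := (hsum f).mapL (B.flip h)
  simp only [hPQ] at h1
  exact h1.unique (hS.hasSum.mapL (B f))

end Decomposition

end Duality

/-! ### The integral pairing of `L^p` and `L^q`, and dense test functions. -/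

section LpPairing

variable {M : Type*} [MeasurableSpace M]

/-- The pairing `∫ f h dν` of `L^p(ν)` and `L^q(ν)` for conjugate exponents. -/
def lpPairing (ν : Measure M) (p q : ℝ≥0∞) [Fact (1 ≤ p)] [Fact (1 ≤ q)] [p.HolderConjugate q] :
    Lp ℝ p ν →L[ℝ] Lp ℝ q ν →L[ℝ] ℝ :=
  (ContinuousLinearMap.mul ℝ ℝ).lpPairing ν p q

variable {ν : Measure M} {p q : ℝ≥0∞} [Fact (1 ≤ p)] [Fact (1 ≤ q)] [p.HolderConjugate q]

theorem lpPairing_apply (f : Lp ℝ p ν) (h : Lp ℝ q ν) :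
    lpPairing ν p q f h = ∫ x, f x * h x ∂ν := by
  rw [lpPairing, ContinuousLinearMap.lpPairing_eq_integral]
  rfl

theorem lpPairing_toLp {f h : M → ℝ} (hf : MemLp f p ν) (hh : MemLp h q ν) :
    lpPairing ν p q (hf.toLp f) (hh.toLp h) = ∫ x, f x * h x ∂ν := by
  rw [lpPairing_apply]
  refine integral_congr_ae ?_
  filter_upwards [hf.coeFn_toLp, hh.coeFn_toLp] with x h1 h2
  rw [h1, h2]

theorem isLpAdjoint_iff {A : Lp ℝ p ν →L[ℝ] Lp ℝ p ν} {A' : Lp ℝ q ν →L[ℝ] Lp ℝ q ν} :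
    IsLpAdjoint ν p q A A' ↔ ∀ f h, lpPairing ν p q (A f) h = lpPairing ν p q f (A' h) := by
  simp only [IsLpAdjoint, lpPairing_apply]

theorem lpPairing_le (f : Lp ℝ p ν) (h : Lp ℝ q ν) : lpPairing ν p q f h ≤ ‖f‖ * ‖h‖ := by
  have h1 : lpPairing ν p q f h =
      ∫ x, ((ContinuousLinearMap.mul ℝ ℝ).holder 1 f h : Lp ℝ 1 ν) x ∂ν := by
    rw [lpPairing_apply]
    exact integral_congr_ae ((ContinuousLinearMap.mul ℝ ℝ).coeFn_holder f h).symm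
  have h2 := (ContinuousLinearMap.mul ℝ ℝ).norm_holder_apply_apply_le (r := 1) f h
  calc lpPairing ν p q f h ≤ ‖lpPairing ν p q f h‖ := Real.le_norm_self _
    _ ≤ ‖((ContinuousLinearMap.mul ℝ ℝ).holder 1 f h : Lp ℝ 1 ν)‖ := by
        rw [h1, ← L1.integral_eq_integral]
        exact L1.norm_integral_le _
    _ ≤ ‖ContinuousLinearMap.mul ℝ ℝ‖ * ‖f‖ * ‖h‖ := h2
    _ ≤ 1 * ‖f‖ * ‖h‖ := by gcongr; exact ContinuousLinearMap.opNorm_mul_le ℝ ℝ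
    _ = ‖f‖ * ‖h‖ := by rw [one_mul]

theorem norm_rpow_eq_integral (hq : q ≠ ⊤) (h : Lp ℝ q ν) :
    ‖h‖ ^ q.toReal = ∫ x, |h x| ^ q.toReal ∂ν := by
  have hq0 : q ≠ 0 := (zero_lt_one.trans_le (Fact.out : 1 ≤ q)).ne'
  have hpos := ENNReal.toReal_pos hq0 hq
  rw [Lp.norm_def, (Lp.memLp h).eLpNorm_eq_integral_rpow_norm hq0 hq, ENNReal.toReal_ofReal
    (by positivity), Real.rpow_inv_rpow (integral_nonneg fun x => by positivity) hpos.ne']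
  rfl

theorem exists_norming (hp : p ≠ ⊤) (hq : q ≠ ⊤) (hpq : p.toReal.HolderConjugate q.toReal)
    (h : Lp ℝ q ν) : ∃ f : Lp ℝ p ν,
      lpPairing ν p q f h = ‖h‖ ^ q.toReal ∧ ‖f‖ ^ p.toReal = ‖h‖ ^ q.toReal := by
  set s := q.toReal with hs
  -- The equality case of Hölder: `F * h = |h| ^ s`, and `|F| ^ r = |h| ^ s` because `(s - 1) * r =
  -- s`, where `r = p.toReal`.
  set F : M → ℝ := fun x => SignType.sign (h x) * |h x| ^ (s - 1) with hF
  have hs1 : 0 < s - 1 := hpq.symm.sub_one_pos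
  have hmeas : AEStronglyMeasurable F ν := by
    have hm : AEMeasurable h ν := (Lp.aestronglyMeasurable h).aemeasurable
    have hsgn : Measurable fun y : ℝ => ((SignType.sign y : SignType) : ℝ) := by
      have : (fun y : ℝ => ((SignType.sign y : SignType) : ℝ)) =
          fun y => if 0 < y then 1 else if y < 0 then -1 else 0 := by
        ext y
        rw [sign_apply]
        split_ifs <;> simp
      rw [this]
      exact Measurable.ite measurableSet_Ioi measurable_const
        (Measurable.ite measurableSet_Iio measurable_const measurable_const)
    have hpw : Measurable fun y : ℝ => |y| ^ (s - 1) := measurable_norm.pow_const (s - 1)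
    exact ((hsgn.mul hpw).comp_aemeasurable hm).aestronglyMeasurable
  have habs : ∀ x, ‖F x‖ = ‖h x‖ ^ (s - 1) := fun x => by
    rcases eq_or_ne (h x) 0 with h0 | h0
    · simp [hF, h0, Real.zero_rpow hs1.ne']
    · rw [hF, norm_mul]
      have : ‖((SignType.sign (h x) : SignType) : ℝ)‖ = 1 := by
        rcases lt_or_gt_of_ne h0 with h1 | h1 <;> simp [h1]
      rw [this, one_mul, Real.norm_of_nonneg (by positivity), Real.norm_eq_abs]
  have hnorm : eLpNorm F p ν = eLpNorm h q ν ^ (s - 1) := by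
    have h1 : eLpNorm F p ν = eLpNorm (fun x => ‖h x‖ ^ (s - 1)) p ν :=
      eLpNorm_congr_norm_ae (Filter.Eventually.of_forall fun x => by
        rw [habs, Real.norm_of_nonneg (Real.rpow_nonneg (norm_nonneg _) _)])
    rw [h1, eLpNorm_norm_rpow _ hs1]
    congr 2
    nth_rewrite 1 [← ENNReal.ofReal_toReal hp]
    rw [← ENNReal.ofReal_mul hpq.nonneg, ← ENNReal.ofReal_toReal hq]
    congr 1
    have := hpq.symm.sub_one_mul_conj
    rw [mul_comm]
    exact this
  have hmem : MemLp F p ν := ⟨hmeas, by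
    rw [hnorm]; exact ENNReal.rpow_lt_top_of_nonneg hs1.le (Lp.memLp h).2.ne⟩
  refine ⟨hmem.toLp F, ?_, ?_⟩
  · rw [norm_rpow_eq_integral hq, lpPairing_apply]
    refine integral_congr_ae ?_
    filter_upwards [hmem.coeFn_toLp] with x hx
    rw [hx]
    rcases eq_or_ne (h x) 0 with h0 | h0
    · rw [h0, mul_zero, abs_zero, Real.zero_rpow hpq.symm.ne_zero]
    · have hpow : |h x| ^ s = |h x| ^ (s - 1) * |h x| := by
        rw [Real.rpow_sub_one (abs_ne_zero.2 h0), div_mul_cancel₀ _ (abs_ne_zero.2 h0)]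
      rw [hpow]
      simp only [hF]
      linear_combination |h x| ^ (s - 1) * sign_mul_self (h x)
  · rw [Lp.norm_toLp, hnorm, ← ENNReal.toReal_rpow, ← Lp.norm_def, ← Real.rpow_mul (norm_nonneg _),
      hpq.symm.sub_one_mul_conj]

end LpPairing

theorem dense_compactlySupported_Lp {M : Type*} [TopologicalSpace M] [T2Space M]
    [NormalSpace M] [LocallyCompactSpace M] [MeasurableSpace M] [BorelSpace M]
    (ν : Measure M) [ν.Regular]
    (p : ℝ≥0∞) [Fact (1 ≤ p)] (hp : p ≠ ⊤) :
    Dense {f : Lp ℝ p ν | ∃ (φ : C₀(M, ℝ)) (hφ : MemLp φ p ν), f = hφ.toLp φ} := by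
  intro f
  rw [Metric.mem_closure_iff]
  intro ε hε
  obtain ⟨φ, hc, hle, hcont, hmem⟩ := (Lp.memLp f).exists_hasCompactSupport_eLpNorm_sub_le hp
    (ε := ENNReal.ofReal (ε / 2)) (by simpa using hε)
  refine ⟨hmem.toLp φ, ⟨⟨⟨φ, hcont⟩, hc.is_zero_at_infty⟩, hmem, rfl⟩, ?_⟩
  rw [dist_comm, dist_eq_norm, ← Lp.toLp_coeFn f (Lp.memLp f), ← MemLp.toLp_sub, Lp.norm_toLp,
    eLpNorm_sub_comm]
  refine lt_of_le_of_lt (ENNReal.toReal_mono ENNReal.ofReal_ne_top hle) ?_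
  rw [ENNReal.toReal_ofReal (by positivity)]
  linarith

/-! ### Adjoints on `L^p` of operators induced by `H`-operators. -/

section Adjoint

variable {d : ℕ} {M : Type*} [TopologicalSpace M] [T2Space M]
  [ChartedSpace (EuclideanSpace ℝ (Fin d)) M] [IsManifold (𝓡 d) ∞ M]
  [MeasurableSpace M] [BorelSpace M]

theorem memLp_of_mem_localizedHOperators {U : Set M} {T : C₀(M, ℝ) →L[ℝ] C₀(M, ℝ)}
    {p : ℝ≥0∞}
    {g : SmoothRiemannianMetric d M} (hT : T ∈ localizedHOperators d U) (f : C₀(M, ℝ)) :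
    MemLp (T f) p (riemannianMeasure g) :=
  (T f).continuous.memLp_of_hasCompactSupport (hasCompactSupport_of_mem_localizedHOperators hT f)

variable {p q : ℝ≥0∞} [Fact (1 ≤ p)] [Fact (1 ≤ q)] [p.HolderConjugate q]
  {g : SmoothRiemannianMetric d M}

theorem lpPairing_extension {U : Set M} {T T' : C₀(M, ℝ) →L[ℝ] C₀(M, ℝ)}
    {A : Lp ℝ p (riemannianMeasure g) →L[ℝ] Lp ℝ p (riemannianMeasure g)}
    (hT' : T' ∈ localizedHOperators d U)
    (hTT' : ∀ f h : C₀(M, ℝ),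
      ∫ x, T f x * h x ∂(riemannianMeasure g) = ∫ x, f x * T' h x ∂(riemannianMeasure g))
    (hA : IsLpExtension (riemannianMeasure g) p T A) {φ h : C₀(M, ℝ)}
    (hφ : MemLp φ p (riemannianMeasure g)) (hh : MemLp h q (riemannianMeasure g)) :
    lpPairing (riemannianMeasure g) p q (hφ.toLp φ)
        ((memLp_of_mem_localizedHOperators hT' h).toLp (T' h)) =
      lpPairing (riemannianMeasure g) p q (A (hφ.toLp φ)) (hh.toLp h) := by
  rw [lpPairing_toLp, lpPairing_apply, ← hTT']
  refine integral_congr_ae ?_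
  filter_upwards [hA φ hφ, hh.coeFn_toLp] with x h1 h2
  rw [h1, h2]

variable [SecondCountableTopology M]

/-- Both sides are continuous in `f` and agree on a dense set of test functions. Thus `T' h` is the
value of the adjoint at `h`, which is the input of `exists_adjoint_of_dense`. -/
theorem lpPairing_extension_of_dense [LocallyCompactSpace M] [(riemannianMeasure g).Regular]
    (hp : p ≠ ⊤) {U : Set M} {T T' : C₀(M, ℝ) →L[ℝ] C₀(M, ℝ)}
    {A : Lp ℝ p (riemannianMeasure g) →L[ℝ] Lp ℝ p (riemannianMeasure g)}
    (hT' : T' ∈ localizedHOperators d U)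
    (hTT' : ∀ f h : C₀(M, ℝ),
      ∫ x, T f x * h x ∂(riemannianMeasure g) = ∫ x, f x * T' h x ∂(riemannianMeasure g))
    (hA : IsLpExtension (riemannianMeasure g) p T A) {h : C₀(M, ℝ)}
    (hh : MemLp h q (riemannianMeasure g)) (f : Lp ℝ p (riemannianMeasure g)) :
    lpPairing (riemannianMeasure g) p q f
        ((memLp_of_mem_localizedHOperators hT' h).toLp (T' h)) =
      lpPairing (riemannianMeasure g) p q (A f) (hh.toLp h) := by
  set B := lpPairing (riemannianMeasure g) p q
  have h1 : Continuous fun f => B f ((memLp_of_mem_localizedHOperators hT' h).toLp (T' h)) :=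
    (B.flip _).continuous
  have h2 : Continuous fun f => B (A f) (hh.toLp h) := (B.flip _).continuous.comp A.continuous
  refine congrFun (h1.ext_on (dense_compactlySupported_Lp _ p hp) h2 ?_) f
  rintro _ ⟨φ, hφ, rfl⟩
  exact lpPairing_extension hT' hTT' hA hφ hh

/-- `A' h` and `T' h` have the same pairing with every element of `L^p`, and the pairing separates
`L^q`. This makes the adjoint again an `H`-operator localized on `U`. -/
theorem isLpExtension_adjoint {U : Set M} [LocallyCompactSpace M] [(riemannianMeasure g).Regular]
    (hp : p ≠ ⊤) (hq : q ≠ ⊤) (hpq : p.toReal.HolderConjugate q.toReal)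
    {T T' : C₀(M, ℝ) →L[ℝ] C₀(M, ℝ)}
    {A : Lp ℝ p (riemannianMeasure g) →L[ℝ] Lp ℝ p (riemannianMeasure g)}
    {A' : Lp ℝ q (riemannianMeasure g) →L[ℝ] Lp ℝ q (riemannianMeasure g)}
    (hT' : T' ∈ localizedHOperators d U)
    (hTT' : ∀ f h : C₀(M, ℝ),
      ∫ x, T f x * h x ∂(riemannianMeasure g) = ∫ x, f x * T' h x ∂(riemannianMeasure g))
    (hA : IsLpExtension (riemannianMeasure g) p T A)
    (hAA' : IsLpAdjoint (riemannianMeasure g) p q A A') :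
    IsLpExtension (riemannianMeasure g) q T' A' := by
  intro h hh
  have : A' (hh.toLp h) = (memLp_of_mem_localizedHOperators hT' h).toLp (T' h) :=
    eq_of_forall_pairing_eq (B := lpPairing (riemannianMeasure g) p q) hpq.symm.ne_zero
      (exists_norming hp hq hpq) fun f => by
        rw [lpPairing_extension_of_dense hp hT' hTT' hA hh, isLpAdjoint_iff.1 hAA']
  rw [this]
  exact MemLp.coeFn_toLp _

theorem exists_isLpAdjoint {U : Set M} [LocallyCompactSpace M] [(riemannianMeasure g).Regular]
    (hp : p ≠ ⊤) (hq : q ≠ ⊤) (hpq : p.toReal.HolderConjugate q.toReal)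
    {T : C₀(M, ℝ) →L[ℝ] C₀(M, ℝ)} (hT : T ∈ localizedHOperators d U)
    {A : Lp ℝ p (riemannianMeasure g) →L[ℝ] Lp ℝ p (riemannianMeasure g)}
    (hA : IsLpExtension (riemannianMeasure g) p T A) :
    ∃ A' : Lp ℝ q (riemannianMeasure g) →L[ℝ] Lp ℝ q (riemannianMeasure g),
      IsLpAdjoint (riemannianMeasure g) p q A A' := by
  obtain ⟨T', hT', hTT'⟩ := exists_adjoint_mem_localizedHOperators g hT
  obtain ⟨A', hA'⟩ := exists_adjoint_of_dense (B := lpPairing (riemannianMeasure g) p q) hpq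
    lpPairing_le (exists_norming hp hq hpq) A
    ((dense_compactlySupported_Lp (riemannianMeasure g) q hq).mono (by
      rintro _ ⟨h, hh, rfl⟩
      exact ⟨_, lpPairing_extension_of_dense hp hT' hTT' hA hh⟩))
  exact ⟨A', isLpAdjoint_iff.2 hA'⟩

end Adjoint

end HestenesDecomposition

end

/-! ### The theorem. -/

theorem mainTheorem11 {d : ℕ} {M : Type*} [TopologicalSpace M] [T2Space M]
    [SecondCountableTopology M] [ConnectedSpace M]
    [ChartedSpace (EuclideanSpace ℝ (Fin d)) M] [IsManifold (𝓡 d) ∞ M]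
    [MeasurableSpace M] [BorelSpace M]
    (g : HestenesDecomposition.SmoothRiemannianMetric d M)
    (𝒰 : Set (Set M)) (h𝒰 : HestenesDecomposition.IsOpenPrecompactCover 𝒰)
    (p q : ℝ≥0∞) [Fact (1 ≤ p)] [Fact (1 ≤ q)] (hp : 1 < p) (hp' : p < ⊤)
    (hpq : 1 / p + 1 / q = 1)
    (P : 𝒰 → Lp ℝ p (HestenesDecomposition.riemannianMeasure g) →L[ℝ]
      Lp ℝ p (HestenesDecomposition.riemannianMeasure g))
    (hP : HestenesDecomposition.IsSmoothDecomposition g 𝒰 p P) :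
    (∀ U : 𝒰, ∃! Q : Lp ℝ q (HestenesDecomposition.riemannianMeasure g) →L[ℝ]
        Lp ℝ q (HestenesDecomposition.riemannianMeasure g),
      HestenesDecomposition.IsLpAdjoint (HestenesDecomposition.riemannianMeasure g) p q
        (P U) Q) ∧
    ∀ Q : 𝒰 → Lp ℝ q (HestenesDecomposition.riemannianMeasure g) →L[ℝ]
        Lp ℝ q (HestenesDecomposition.riemannianMeasure g),
      (∀ U : 𝒰, HestenesDecomposition.IsLpAdjoint
        (HestenesDecomposition.riemannianMeasure g) p q (P U) (Q U)) →
      HestenesDecomposition.IsSmoothDecomposition g 𝒰 q Q ∧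
      (p = 2 →
        HestenesDecomposition.IsDecompositionConstant
          (HestenesDecomposition.riemannianMeasure g) p P 1 →
        HestenesDecomposition.IsDecompositionConstant
          (HestenesDecomposition.riemannianMeasure g) q Q 1) := by
  have hpt : p ≠ ⊤ := hp'.ne
  have hconj : p.HolderConjugate q := ENNReal.holderConjugate_iff.2 (by simpa using hpq)
  have hqt : q ≠ ⊤ := by
    rintro rfl
    have : p = 1 := by simpa using hpq
    exact hp.ne' this
  have hrs : p.toReal.HolderConjugate q.toReal := by
    refine Real.holderConjugate_iff.2 ⟨?_, ?_⟩
    · simpa using (ENNReal.toReal_lt_toReal ENNReal.one_ne_top hpt).2 hp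
    · have hq0 : q ≠ 0 := (zero_lt_one.trans_le (Fact.out : 1 ≤ q)).ne'
      have := congrArg ENNReal.toReal hpq
      rw [ENNReal.toReal_add (by simpa using (zero_lt_one.trans hp).ne')
        (by simpa using hq0)] at this
      simpa using this
  have : LocallyCompactSpace M := ChartedSpace.locallyCompactSpace (EuclideanSpace ℝ (Fin d)) M
  -- Some compatible metric is chosen only to obtain regularity of the locally finite measure,
  -- needed for density of test functions.
  let _ : MetricSpace M := TopologicalSpace.metrizableSpaceMetric M
  have hreg : (HestenesDecomposition.riemannianMeasure g).Regular := inferInstance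
  have hN := HestenesDecomposition.exists_norming
    (ν := HestenesDecomposition.riemannianMeasure g) hpt hqt hrs
  have hB := HestenesDecomposition.lpPairing_le
    (ν := HestenesDecomposition.riemannianMeasure g) (p := p) (q := q)
  have huniq : ∀ {A Q Q'}, HestenesDecomposition.IsLpAdjoint
      (HestenesDecomposition.riemannianMeasure g) p q A Q →
      HestenesDecomposition.IsLpAdjoint
      (HestenesDecomposition.riemannianMeasure g) p q A Q' → Q = Q' := by
    intro A Q Q' h h'
    rw [HestenesDecomposition.isLpAdjoint_iff] at h h'
    ext1 k
    exact HestenesDecomposition.eq_of_forall_pairing_eq hrs.symm.ne_zero hN fun f => by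
      rw [← h, ← h']
  refine ⟨fun U => ?_, fun Q hQ => ?_⟩
  · obtain ⟨T, hT, hTP⟩ := hP.localized U
    obtain ⟨A, hA⟩ := HestenesDecomposition.exists_isLpAdjoint (q := q) hpt hqt hrs hT hTP
    exact ⟨A, hA, fun A' hA' => huniq hA' hA⟩
  have hPQ := fun U => HestenesDecomposition.isLpAdjoint_iff.1 (hQ U)
  -- `IsDecompositionConstant` unfolds to `HasDecompositionBound` with exponent `p.toReal`, so the
  -- abstract bound applies directly.
  have hconst : ∀ C, HestenesDecomposition.IsDecompositionConstant
      (HestenesDecomposition.riemannianMeasure g) p P C →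
      HestenesDecomposition.IsDecompositionConstant
        (HestenesDecomposition.riemannianMeasure g) q Q (max C (C ^ 2)) := fun C hC =>
    HestenesDecomposition.hasDecompositionBound_adjoint hrs hB hN hPQ hP.projection
      hP.comp_eq_zero hP.hasSum hC
  obtain ⟨C, hC⟩ := hP.exists_constant
  refine ⟨⟨fun K hK => (hP.locally_finite K hK).subset ?_, fun U => ?_, fun U => ?_,
    fun U U' hU => ?_, ?_, ⟨_, hconst C hC⟩⟩, fun _ h => by simpa using hconst 1 h⟩
  -- If `P U = 0` then zero is an adjoint of it, so `Q U = 0` by uniqueness; local finiteness is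
  -- inherited.
  · rintro U ⟨hUK, hU⟩
    refine ⟨hUK, fun h0 => hU (huniq (hQ U) ?_)⟩
    rw [h0, HestenesDecomposition.isLpAdjoint_iff]
    simp
  · obtain ⟨T, hT, hTP⟩ := hP.localized U
    obtain ⟨T', hT', hTT'⟩ :=
      HestenesDecomposition.exists_adjoint_mem_localizedHOperators g hT
    exact ⟨T', hT', HestenesDecomposition.isLpExtension_adjoint hpt hqt hrs hT' hTT' hTP (hQ U)⟩
  · exact HestenesDecomposition.comp_adjoint_eq hrs.symm.ne_zero hN hPQ (hP.projection U)
  · exact HestenesDecomposition.adjoint_comp_eq_zero hrs.symm.ne_zero hN hPQ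
      (hP.comp_eq_zero U' U hU.symm)
  · exact HestenesDecomposition.hasSum_adjoint hrs hB hN hPQ hP.projection
      hP.comp_eq_zero hP.hasSum hC
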